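/- A closed curve in $\mathbb{R}^d$ is represented by a $1$-periodic map $X:\mathbb{R}\to\mathbb{R}^d$ that is Lipschitz, has a derivative of bounded variation on a period, and is not constant on any nondegenerate interval; $\mathcal{C}_e$ denotes the set of these parametrizations. Let $L(X)=\int_0^1|X'(r)|\,dr$ be the length, $\varphi_X(r)=\frac1{L(X)}\int_0^r|X'(\rho)|\,d\rho$, and let $R(X)=X\circ\varphi_X^{-1}$ be the normal reparametrization. For $\tau\ge 0$ let $e^{\tau\partial_{ss}}$ denote the heat semigroup on $1$-periodic functions. Given $X_0\in\mathcal{C}_e$ and an integer $n\ge 1$, put $h=\frac1n$, $Y_0=X_0$, $$ Y_{k+1}=e^{\frac{h}{L(Y_k)^2}\partial_{ss}}R(Y_k),\qquad X^n(t)=e^{\frac{t-kh}{L(Y_k)^2}\partial_{ss}}R(Y_k)\quad\text{for } t\in[kh,(k+1)h),\ k=0,1,2,\dots, $$ so that $X^n(0)=R(X_0)$. Fix an orthonormal basis of $\mathbb{R}^d$ and let $X^1,\dots,X^d$ be the components of a curve $X$ in it. An extremity point of $X$ is a pair $(i,r)$ with $i\in\{1,\dots,d\}$ and $r\in[0,1)$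 such that either $X^i$ is differentiable at $r$ with $\partial_rX^i(r)=0$, or $X^i$ is not differentiable at $r$ and has a local maximum or minimum there. (Thus points are counted by parameter value, separately for each component, and without multiplicity.) **Proposition.** Let $X_0\in\mathcal{C}_e$ be such that, in the fixed basis, the curve admits a parametrization with finitely many extremity points, i.e. some $Y=X_0\circ\varphi\in\mathcal{C}_e$, where $\varphi$ is a (possibly orientation reversing) homeomorphism of the circle $\mathbb{R}/\mathbb{Z}$, has finitely many extremity points. Then, for every $n\ge1$, the number of extremity points of $X^n(t)$ in the same basis is finite for all $t\ge0$ and is a non-increasing function of $t\in[0,\infty)$. -/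

import Mathlib

open MeasureTheory ProbabilityTheory Set

noncomputable section

namespace CurveFlow

variable {d : ℕ}

/-- `EuclideanSpace ℝ (Fin d)`, the ambient Euclidean space. Closed curves are represented by
1-periodic maps `ℝ → E d`, that is, by maps on the circle `ℝ / ℤ`. -/
abbrev E (d : ℕ) : Type := EuclideanSpace ℝ (Fin d)

/-- Essentially parametrized closed curves: 1-periodic, of class `W^{1,∞}` (i.e. Lipschitz), with
derivative in `BV` (i.e. almost everywhere equal to a 1-periodic function of bounded variation),
and not constant on any nondegenerate interval. -/
structure IsClosedCurve (X : ℝ → E d) : Prop where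
  periodic : Function.Periodic X 1
  lipschitz : ∃ K, LipschitzWith K X
  deriv_bv : ∃ Z : ℝ → E d, Function.Periodic Z 1 ∧ BoundedVariationOn Z (Icc 0 1) ∧
    deriv X =ᵐ[volume] Z
  essential : ∀ a b : ℝ, a < b → ∃ r ∈ Icc a b, ∃ r' ∈ Icc a b, X r ≠ X r'

/-- The length `L(X) = ∫₀¹ |X'|`. -/
def length (X : ℝ → E d) : ℝ := ∫ r in (0 : ℝ)..1, ‖deriv X r‖

/-- The normalized arc length function `φ_X(r) = L(X)⁻¹ ∫₀ʳ |X'|`. For a closed curve as above it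
is an increasing homeomorphism of `ℝ` with `φ_X(r + 1) = φ_X(r) + 1`. -/
def normArc (X : ℝ → E d) (r : ℝ) : ℝ := (length X)⁻¹ * ∫ ρ in (0 : ℝ)..r, ‖deriv X ρ‖

/-- The normal reparametrization `R(X) = X ∘ φ_X⁻¹`. -/
def normalize (X : ℝ → E d) : ℝ → E d := fun s => X (Function.invFun (normArc X) s)

/-- The heat semigroup `e^{τ ∂_ss}` (`τ ≥ 0`) on continuous periodic maps: convolution with the
heat kernel `(4πτ)^{-1/2} exp (-y² / (4τ))`, the centred Gaussian law of variance `2τ`, which for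
`τ = 0` is the Dirac mass at `0`. -/
def heat (τ : ℝ) (X : ℝ → E d) : ℝ → E d :=
  fun s => ∫ y, X (s - y) ∂(gaussianReal 0 (2 * τ).toNNReal)

/-- The end value at time `k h`, `h = 1 / n`, of the linear evolution on the preceding time
interval, before it is reparametrized; for `k = 0` it is the initial curve. -/
def juncture (X₀ : ℝ → E d) (n : ℕ) : ℕ → ℝ → E d
  | 0 => X₀
  | k + 1 => heat ((1 / (n : ℝ)) / length (juncture X₀ n k) ^ 2) (normalize (juncture X₀ n k))

/-- The approximant `X^n(t)`: for `t ∈ [k h, (k + 1) h)` with `h = 1 / n`, it is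
`e^{(t - k h) / L² ∂_ss}` applied to the normal reparametrization of the curve reached at time
`k h`, where `L` is the length of that curve. -/
def approximant (X₀ : ℝ → E d) (n : ℕ) (t : ℝ) : ℝ → E d :=
  heat ((t - (⌊(n : ℝ) * t⌋₊ : ℝ) * (1 / (n : ℝ))) / length (juncture X₀ n ⌊(n : ℝ) * t⌋₊) ^ 2)
    (normalize (juncture X₀ n ⌊(n : ℝ) * t⌋₊))

/-- `r` is an extremity parameter of the scalar function `f`: `f'(r) = 0`, or `f` has a local
maximum or minimum at `r` (this adds only points where `f` is not differentiable). -/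
def IsExtremity (f : ℝ → ℝ) (r : ℝ) : Prop := HasDerivAt f 0 r ∨ IsLocalExtr f r

/-- The extremity points of `X` in the coordinate system with axes `b`: the pairs of a component
and a parameter in one period at which that component has an extremity. -/
def extremitySet (b : OrthonormalBasis (Fin d) ℝ (E d)) (X : ℝ → E d) : Set (Fin d × ℝ) :=
  {p | p.2 ∈ Ico (0 : ℝ) 1 ∧ IsExtremity (fun r => b.repr (X r) p.1) p.2}

/-- The number of extremity points of `X` in the coordinate system with axes `b`. -/
def extremityNumber (b : OrthonormalBasis (Fin d) ℝ (E d)) (X : ℝ → E d) : ℕ∞ :=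
  (extremitySet b X).encard

/-- `Y` parametrizes the same closed curve as `X`: `Y = X ∘ φ` for a homeomorphism `φ` of the
circle `ℝ / ℤ`, which may reverse the orientation. -/
def IsReparametrization (X Y : ℝ → E d) : Prop :=
  ∃ φ : ℝ → ℝ, Continuous φ ∧
    ((StrictMono φ ∧ ∀ r, φ (r + 1) = φ r + 1) ∨ (StrictAnti φ ∧ ∀ r, φ (r + 1) = φ r - 1)) ∧
    Y = X ∘ φ

/-- The curve parametrized by `X` has finitely many extremity points in the coordinate system with
axes `b`: it admits a parametrization with finitely many extremity points. -/
def HasFinitelyManyExtremityPoints (b : OrthonormalBasis (Fin d) ℝ (E d)) (X : ℝ → E d) : Prop :=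
  ∃ Y : ℝ → E d, IsReparametrization X Y ∧ IsClosedCurve Y ∧ (extremitySet b Y).Finite

end CurveFlow

end

namespace CurveFlow

open Filter Topology NNReal

/-! Two operations act on the curve, and neither increases the number of extremity points. For the
normal reparametrization this is elementary. The arc length function is Lipschitz, so an extremity
of `normalize X` at `normArc X r` pulls back to an extremity of `X` at `r`. Only this direction is
used.

For the heat flow, each component is treated separately, and the principle is variation diminishing:
convolution with a Gaussian does not increase the number of cyclic sign changes of the derivative.
The Gaussian is the limit of symmetric random walks. One step of the walk replaces the increments
along a grid by averages of neighbours, and the sum of two neighbours has the sign of one of them,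
so no sign change is created (`Alternates.of_add_shift`). Lévy's continuity theorem carries this to
the limit (`Alternates.of_heatR`).

Sign changes are not zeros, however: the evolved derivative may vanish at a point without changing
sign. This is repaired by perturbing the derivative `g` of `f` to `(1 + εψ)g`, with `εψ` smaller
than one in absolute value, so that the signs of `g` are kept. The factor `ψ` is chosen so that the
evolution of `ψg` has any prescribed signs at the zeros in question, while the mean of `ψg` is zero
and the perturbed primitive stays periodic (`exists_factor_heatR_eq`). This is possible because
translates of the circle heat kernel are linearly independent together with the constants, and
because `g` vanishes almost everywhere on no interval. Hence zeros of the evolved derivative, read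
with convenient signs, force as many strict sign changes of `g`, and so as many local extrema of `f`
(`alternates_deriv_of_heatR_weak`, `encard_extremities_heatR_le`). -/

/-! ### Cyclic sign changes under neighbour averaging. -/

/-- `d` takes values of alternating sign at `q` points in cyclic order along a period `T`. -/
def Alternates {R : Type*} [Ring R] [LinearOrder R] (d : R → ℝ) (T : R) (q : ℕ) : Prop :=
  ∃ k : ℕ → R, (∀ j < q, k j < k (j + 1)) ∧ k q = k 0 + T ∧ ∀ j < q, 0 < (-1) ^ j * d (k j)

/-- Averaging neighbours does not increase the number of cyclic sign changes. -/
theorem Alternates.of_add_shift {d : ℤ → ℝ} {T : ℤ} {q : ℕ} (hd : Function.Periodic d T)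
    (hq : Even q) (h : Alternates (fun i => d i + d (i + 1)) T q) : Alternates d T q := by
  obtain ⟨k, hk, hkT, hs⟩ := h
  -- A sum with the sign `(-1) ^ j` has a summand of that sign, at `k j` or at `k j + 1`.
  set k' : ℕ → ℤ := fun j => if 0 < (-1) ^ j * d (k j) then k j else k j + 1 with hk'
  have hlo : ∀ j, k j ≤ k' j := fun j => by simp only [hk']; split_ifs <;> omega
  have hhi : ∀ j, k' j ≤ k j + 1 := fun j => by simp only [hk']; split_ifs <;> omega
  have hsgn : ∀ j < q, 0 < (-1) ^ j * d (k' j) := by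
    intro j hj
    simp only [hk']
    split_ifs with h0
    · exact h0
    · have := hs j hj
      simp only [mul_add] at this
      linarith
  have hend : k' q = k' 0 + T := by
    simp only [hk', hkT, hd (k 0), hq.neg_one_pow, pow_zero]
    split_ifs <;> ring
  have hsgn' : ∀ j ≤ q, 0 < q → 0 < (-1) ^ j * d (k' j) := by
    intro j hj h0
    rcases hj.lt_or_eq with h | rfl
    · exact hsgn j h
    · rw [hend, hd, hq.neg_one_pow]
      simpa using hsgn 0 h0
  refine ⟨k', fun j hj => ?_, hend, hsgn⟩
  have h1 := hhi j
  have h2 := hlo (j + 1)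
  have h3 := hk j hj
  -- The choices are ordered up to ties, and a tie would give one value of `d` two opposite signs.
  -- At the closing index this relies on `q` being even.
  refine lt_of_le_of_ne (by omega) fun heq => ?_
  have h4 := hsgn j hj
  have h5 := hsgn' (j + 1) hj (by omega)
  rw [← heq, pow_succ] at h5
  linarith

/-- One step of the symmetric random walk of span `h` applied to a function. -/
noncomputable def walkStep (h : ℝ) (f : ℝ → ℝ) (s : ℝ) : ℝ := (f (s - h / 2) + f (s + h / 2)) / 2

/-- The increments of `f` along the grid `c + hℤ`. -/
def gridDiff (h c : ℝ) (f : ℝ → ℝ) (i : ℤ) : ℝ := f (c + (i + 1) * h) - f (c + i * h)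

/-- Jumps of half a mesh in either direction send the grid into one and the same shifted grid, so
the new increments are averages of adjacent old ones. The offset of the grid therefore moves with
every step. -/
theorem gridDiff_walkStep (h c : ℝ) (f : ℝ → ℝ) (i : ℤ) :
    gridDiff h c (walkStep h f) i =
      (gridDiff h (c - h / 2) f i + gridDiff h (c - h / 2) f (i + 1)) / 2 := by
  have e1 : c + ((i : ℝ) + 1) * h - h / 2 = c - h / 2 + (i + 1) * h := by ring
  have e2 : c + ((i : ℝ) + 1) * h + h / 2 = c - h / 2 + (i + 1 + 1) * h := by ring
  have e3 : c + (i : ℝ) * h - h / 2 = c - h / 2 + i * h := by ring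
  have e4 : c + (i : ℝ) * h + h / 2 = c - h / 2 + (i + 1) * h := by ring
  simp only [gridDiff, walkStep, e1, e2, e3, e4]
  push_cast
  ring

theorem gridDiff_periodic {h c : ℝ} {f : ℝ → ℝ} {M : ℕ} (hf : Function.Periodic f 1)
    (hM : (M : ℝ) * h = 1) : Function.Periodic (gridDiff h c f) (M : ℤ) := by
  intro i
  simp only [gridDiff]
  push_cast
  rw [show c + ((i : ℝ) + M + 1) * h = c + (i + 1) * h + 1 by linear_combination hM,
    show c + ((i : ℝ) + M) * h = c + i * h + 1 by linear_combination hM, hf, hf]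

/-- Repeated random walk steps do not increase the number of sign changes of the increments. -/
theorem Alternates.of_walkStep_iterate {h : ℝ} {f : ℝ → ℝ} {M q : ℕ} (hf : Function.Periodic f 1)
    (hM : (M : ℝ) * h = 1) (hq : Even q) (n : ℕ) (c : ℝ)
    (H : Alternates (gridDiff h c ((walkStep h)^[n] f)) (M : ℤ) q) :
    ∃ c', Alternates (gridDiff h c' f) (M : ℤ) q := by
  induction n generalizing f c with
  | zero => exact ⟨c, H⟩
  | succ n ih =>
    have hper : Function.Periodic (walkStep h f) 1 := by
      intro s
      simp only [walkStep]
      rw [show s + 1 - h / 2 = s - h / 2 + 1 by ring, show s + 1 + h / 2 = s + h / 2 + 1 by ring,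
        hf, hf]
    obtain ⟨c', k, h1, h2, h3⟩ := ih hper c H
    refine ⟨c' - h / 2, Alternates.of_add_shift (gridDiff_periodic hf hM) hq
      ⟨k, h1, h2, fun j hj => ?_⟩⟩
    have := h3 j hj
    rw [gridDiff_walkStep] at this
    linarith

/-! ### Extremities of periodic functions and signs of the derivative. -/

/-- The extremity parameters of a scalar function in one period. -/
def extremities (f : ℝ → ℝ) : Set ℝ := {r | r ∈ Ico (0 : ℝ) 1 ∧ IsExtremity f r}

theorem IsExtremity.fract {f : ℝ → ℝ} (hf : Function.Periodic f 1) {r : ℝ}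
    (h : IsExtremity f r) : IsExtremity f (Int.fract r) := by
  have hff : (fun x => f (x + ⌊r⌋)) = f := by
    funext x
    simpa using hf.int_mul ⌊r⌋ x
  have hcont : ContinuousAt (fun x : ℝ => x + (⌊r⌋ : ℝ)) (Int.fract r) := by fun_prop
  rw [← Int.fract_add_floor r] at h
  rcases h with h | h | h
  · left
    rw [← hff]
    exact h.comp_add_const _ _
  · right; left
    filter_upwards [hcont.tendsto.eventually h] with x hx
    rw [← congrFun hff x, ← congrFun hff (Int.fract r)]
    exact hx
  · right; right
    filter_upwards [hcont.tendsto.eventually h] with x hx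
    rw [← congrFun hff x, ← congrFun hff (Int.fract r)]
    exact hx

theorem fract_mem_extremities {f : ℝ → ℝ} (hf : Function.Periodic f 1) {r : ℝ}
    (h : IsExtremity f r) : Int.fract r ∈ extremities f :=
  ⟨⟨Int.fract_nonneg _, Int.fract_lt_one _⟩, h.fract hf⟩

theorem deriv_periodic {f : ℝ → ℝ} (hf : Function.Periodic f 1) :
    Function.Periodic (deriv f) 1 := by
  intro x
  rw [← deriv_comp_add_const]
  congr 1
  exact funext hf

theorem exists_gt_of_hasDerivAt_pos {u : ℝ → ℝ} {D a b : ℝ} (h : HasDerivAt u D a) (hD : 0 < D)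
    (hab : a < b) : ∃ t ∈ Ioo a b, u a < u t := by
  have h1 := (hasDerivAt_iff_tendsto_slope.1 h).eventually (lt_mem_nhds hD)
  have h2 : ∀ᶠ x in 𝓝[>] a, 0 < slope u a x :=
    h1.filter_mono (nhdsWithin_mono _ fun x hx => ne_of_gt hx)
  obtain ⟨x, hx1, hx2⟩ := (h2.and (Ioo_mem_nhdsGT hab)).exists
  rw [slope_def_field] at hx1
  exact ⟨x, hx2, sub_pos.1 ((div_pos_iff_of_pos_right (sub_pos.2 hx2.1)).1 hx1)⟩

/-- A function whose derivative alternates at `q` points of a period has `q` local extrema. -/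
theorem Alternates.le_encard_extremities {f : ℝ → ℝ} {q : ℕ} (hf : Function.Periodic f 1)
    (hc : Continuous f) (hq : Even q) (H : Alternates (deriv f) 1 q) :
    (q : ℕ∞) ≤ (extremities f).encard := by
  obtain ⟨k, hk, hkT, hs⟩ := H
  have hs' : ∀ j < q, 0 < (-1) ^ j * deriv f (k j) ∧ 0 < (-1) ^ (j + 1) * deriv f (k (j + 1)) := by
    intro j hj
    refine ⟨hs j hj, ?_⟩
    rcases (Nat.succ_le_of_lt hj).lt_or_eq with h | h
    · exact hs _ h
    · simp only [Nat.succ_eq_add_one] at h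
      rw [h, hkT, deriv_periodic hf, hq.neg_one_pow]
      simpa using hs 0 (by omega)
  -- The derivatives at the two ends push the maximum over `[a, b]` into the interior.
  -- Differentiability is needed only at the ends, where it follows from `deriv` being nonzero.
  have hmax : ∀ (u : ℝ → ℝ) (a b : ℝ), a < b → Continuous u → 0 < deriv u a → deriv u b < 0 →
      ∃ e ∈ Ioo a b, IsLocalMax u e := by
    intro u a b hab hu ha hb
    obtain ⟨e, he, hmax⟩ := isCompact_Icc.exists_isMaxOn (nonempty_Icc.2 hab.le) hu.continuousOn
    have hda : HasDerivAt u (deriv u a) a :=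
      (differentiableAt_of_deriv_ne_zero ha.ne').hasDerivAt
    have hdb : HasDerivAt u (deriv u b) b :=
      (differentiableAt_of_deriv_ne_zero hb.ne).hasDerivAt
    have hea : e ≠ a := by
      rintro rfl
      obtain ⟨x, hx, hlt⟩ := exists_gt_of_hasDerivAt_pos hda ha hab
      exact absurd (hmax (Ioo_subset_Icc_self hx)) (not_le.2 hlt)
    have heb : e ≠ b := by
      rintro rfl
      have h1 := (hasDerivAt_iff_tendsto_slope.1 hdb).eventually (gt_mem_nhds hb)
      have h2 : ∀ᶠ x in nhdsWithin e (Iio e), slope u e x < 0 :=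
        h1.filter_mono (nhdsWithin_mono _ fun x hx => ne_of_lt hx)
      have h3 : ∀ᶠ x in nhdsWithin e (Iio e), x ∈ Ioo a e := Ioo_mem_nhdsLT hab
      obtain ⟨x, hx1, hx2⟩ := (h2.and h3).exists
      have h4 := hmax (Ioo_subset_Icc_self hx2)
      rw [slope_comm, slope_def_field] at hx1
      simp only [mem_ofPred_eq] at h4
      linarith [div_nonneg (sub_nonneg.2 h4) (sub_nonneg.2 hx2.2.le)]
    have hIoo : e ∈ Ioo a b := ⟨lt_of_le_of_ne he.1 hea.symm, lt_of_le_of_ne he.2 heb⟩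
    exact ⟨e, hIoo, hmax.isLocalMax (Icc_mem_nhds hIoo.1 hIoo.2)⟩
  have hex : ∀ j : Fin q, ∃ e ∈ Ioo (k j) (k (j + 1)), IsLocalExtr f e := by
    intro j
    obtain ⟨h1, h2⟩ := hs' j j.2
    rcases Nat.even_or_odd (j : ℕ) with hj | hj
    · rw [hj.neg_one_pow] at h1
      rw [hj.add_one.neg_one_pow] at h2
      obtain ⟨e, he, hm⟩ := hmax f _ _ (hk j j.2) hc (by linarith) (by linarith)
      exact ⟨e, he, Or.inr hm⟩
    · rw [hj.neg_one_pow] at h1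
      rw [hj.add_one.neg_one_pow] at h2
      obtain ⟨e, he, hm⟩ := hmax (-f) _ _ (hk j j.2) hc.neg
        (by rw [deriv.neg']; linarith) (by rw [deriv.neg']; linarith)
      exact ⟨e, he, Or.inl (by have := hm.neg; simp only [Pi.neg_apply, neg_neg] at this; exact this)⟩
  choose e he hext using hex
  have hmono : ∀ i j, i ≤ j → j ≤ q → k i ≤ k j := by
    intro i j hij
    induction j, hij using Nat.le_induction with
    | base => intro _; exact le_rfl
    | succ j hij ih => intro hj; exact (ih (by omega)).trans (hk j (by omega)).le
  have hlt : ∀ i j : Fin q, i < j → e i < e j := fun i j hij =>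
    (he i).2.trans (lt_of_le_of_lt (hmono _ _ (Nat.succ_le_of_lt hij) j.2.le) (he j).1)
  -- All the extrema lie in the open interval from `k 0` to `k 0 + 1`, so they remain distinct
  -- modulo one.
  have hinj : Function.Injective fun j => Int.fract (e j) := by
    have key : ∀ i j : Fin q, i < j → Int.fract (e i) ≠ Int.fract (e j) := by
      intro i j hij heq
      obtain ⟨z, hz⟩ := Int.fract_eq_fract.1 heq.symm
      have h1 := hlt i j hij
      have h2 : e j < k 0 + 1 := hkT ▸ (he j).2.trans_le (hmono _ _ j.2 le_rfl)
      have h3 : k 0 < e i := (hmono 0 i (by omega) i.2.le).trans_lt (he i).1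
      have h4 : (0 : ℝ) < z := by linarith
      have h5 : (z : ℝ) < 1 := by linarith
      have h6 : (0 : ℤ) < z := by exact_mod_cast h4
      have h7 : z < (1 : ℤ) := by exact_mod_cast h5
      omega
    intro i j hij
    rcases lt_trichotomy i j with h | h | h
    · exact absurd hij (key i j h)
    · exact h
    · exact absurd hij.symm (key j i h)
  calc (q : ℕ∞) = (range fun j => Int.fract (e j)).encard := by
        rw [← image_univ, hinj.encard_image, encard_univ]; simp
    _ ≤ _ := by
        refine encard_le_encard ?_
        rintro _ ⟨j, rfl⟩
        exact fract_mem_extremities hf (Or.inr (hext j))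

/-! ### Calculus of Lipschitz maps. -/

section Calculus

variable {F : Type*} [NormedAddCommGroup F]

theorem intervalIntegrable_of_bounded {φ : ℝ → F} {C : ℝ} (hm : StronglyMeasurable φ)
    (hb : ∀ x, ‖φ x‖ ≤ C) (a b : ℝ) : IntervalIntegrable φ volume a b :=
  (intervalIntegrable_const (c := C)).mono_fun hm.aestronglyMeasurable
    (Filter.Eventually.of_forall fun x => (hb x).trans (le_abs_self C))

theorem locallyIntegrable_of_bounded {φ : ℝ → F} {C : ℝ} (hm : StronglyMeasurable φ)
    (hb : ∀ x, ‖φ x‖ ≤ C) : LocallyIntegrable φ volume :=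
  (locallyIntegrable_const C).mono hm.aestronglyMeasurable
    (Filter.Eventually.of_forall fun x => (hb x).trans (le_abs_self C))

theorem lipschitzWith_integral_of_bounded [NormedSpace ℝ F] {φ : ℝ → F} {K : NNReal}
    (hm : StronglyMeasurable φ) (hb : ∀ x, ‖φ x‖ ≤ K) (c : ℝ) :
    LipschitzWith K fun x => ∫ t in c..x, φ t := by
  refine LipschitzWith.of_dist_le_mul fun x y => ?_
  have hint := intervalIntegrable_of_bounded hm hb
  rw [dist_eq_norm, intervalIntegral.integral_interval_sub_left (hint _ _) (hint _ _),
    Real.dist_eq]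
  exact intervalIntegral.norm_integral_le_of_norm_le_const fun t _ => hb t

/-- The fundamental theorem of calculus for Lipschitz maps. -/
theorem integral_deriv_of_lipschitz [NormedSpace ℝ F] [FiniteDimensional ℝ F] {f : ℝ → F} {K : NNReal} (hf : LipschitzWith K f) (a b : ℝ) :
    ∫ x in a..b, deriv f x = f b - f a := by
  have hloc : LocallyIntegrable (deriv f) volume :=
    locallyIntegrable_of_bounded (stronglyMeasurable_deriv f) (fun _ => norm_deriv_le_of_lipschitz hf)
  have h1 : AbsolutelyContinuousOnInterval (fun x => ∫ t in a..x, deriv f t) a b :=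
    (lipschitzWith_integral_of_bounded (stronglyMeasurable_deriv f)
      (fun _ => norm_deriv_le_of_lipschitz hf) a).lipschitzOnWith.absolutelyContinuousOnInterval
  have h2 : AbsolutelyContinuousOnInterval f a b :=
    (hf.lipschitzOnWith (s := uIcc a b)).absolutelyContinuousOnInterval
  have h3 := h2.fun_sub h1
  have h4 : ∀ᵐ x, DifferentiableAt ℝ f x := hf.ae_differentiableAt_real
  have h5 := LocallyIntegrable.ae_hasDerivAt_integral hloc
  have h6 : ∀ᵐ x, x ∈ uIcc a b → HasDerivAt (fun x => f x - ∫ t in a..x, deriv f t) 0 x := by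
    filter_upwards [h4, h5] with x hx hx' _
    have := hx.hasDerivAt.fun_sub (hx' a)
    rwa [sub_self] at this
  obtain ⟨C, hC⟩ := h3.const_of_ae_hasDerivAt_zero h6
  have ha := hC a (by simp)
  have hb := hC b (by simp)
  simp only [intervalIntegral.integral_same, sub_zero] at ha
  rw [ha, ← hb]
  abel

end Calculus

/-- A continuous periodic map is bounded. -/
theorem exists_bound_of_periodic {F : Type*} [NormedAddCommGroup F] {f : ℝ → F}
    (hf : Function.Periodic f 1) (hc : Continuous f) : ∃ C, ∀ x, ‖f x‖ ≤ C := by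
  obtain ⟨C, hC⟩ := isCompact_Icc.exists_bound_of_continuousOn (s := Icc (0 : ℝ) 1) hc.continuousOn
  refine ⟨C, fun x => ?_⟩
  obtain ⟨y, hy, hxy⟩ := hf.exists_mem_Ico₀ one_pos x
  rw [hxy]
  exact hC y ⟨hy.1, hy.2.le⟩

/-! ### The heat semigroup on periodic Lipschitz maps. -/

/-- The heat semigroup on scalar functions. -/
noncomputable def heatR (τ : ℝ) (f : ℝ → ℝ) (s : ℝ) : ℝ :=
  ∫ y, f (s - y) ∂(gaussianReal 0 (2 * τ).toNNReal)

theorem integrable_comp_sub_of_bounded {F : Type*} [NormedAddCommGroup F] {μ : Measure ℝ}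
    [IsFiniteMeasure μ] {φ : ℝ → F} {C : ℝ} (hm : StronglyMeasurable φ)
    (hb : ∀ x, ‖φ x‖ ≤ C) (s : ℝ) : Integrable (fun y => φ (s - y)) μ :=
  Integrable.of_bound (hm.comp_measurable (by fun_prop)).aestronglyMeasurable C
    (Filter.Eventually.of_forall fun y => hb _)

theorem ae_sub_left {p : ℝ → Prop} (h : ∀ᵐ x, p x) (s : ℝ) : ∀ᵐ y, p (s - y) :=
  (Measure.measurePreserving_sub_left volume s).quasiMeasurePreserving.ae h

/-- The heat semigroup turns the almost everywhere derivative of a Lipschitz function into the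
derivative of its evolution. -/
theorem hasDerivAt_heatR {τ : ℝ} (hτ : 0 < τ) {f g : ℝ → ℝ} {K : NNReal} {C : ℝ}
    (hf : LipschitzWith K f) (hb : ∀ x, ‖f x‖ ≤ C) (hg : Measurable g)
    (hfg : ∀ᵐ x, HasDerivAt f (g x) x) (x : ℝ) :
    HasDerivAt (heatR τ f) (heatR τ g x) x := by
  have hv : (2 * τ).toNNReal ≠ 0 := by simpa using hτ
  refine (hasDerivAt_integral_of_dominated_loc_of_lip (s := univ) (bound := fun _ => (K : ℝ))
    (F := fun s y => f (s - y)) Filter.univ_mem ?_ ?_ ?_ ?_ (integrable_const _) ?_).2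
  · exact Filter.Eventually.of_forall fun s =>
      (hf.continuous.comp (by fun_prop)).aestronglyMeasurable
  · exact integrable_comp_sub_of_bounded hf.continuous.stronglyMeasurable hb x
  · exact (hg.comp (by fun_prop)).aestronglyMeasurable
  · refine Filter.Eventually.of_forall fun y => ?_
    refine LipschitzWith.lipschitzOnWith (LipschitzWith.of_dist_le_mul fun a b => ?_)
    have := hf.dist_le_mul (a - y) (b - y)
    simpa using this
  -- For `τ > 0` the Gaussian has a density, so the Lebesgue null set where the derivative is not
  -- given by `g` does not matter.
  · refine (gaussianReal_absolutelyContinuous 0 hv).ae_le ?_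
    filter_upwards [ae_sub_left hfg x] with y hy
    simpa using hy.comp_sub_const x y

section Vector

variable {d : ℕ}

theorem heat_periodic {τ : ℝ} {X : ℝ → E d} (hX : Function.Periodic X 1) :
    Function.Periodic (heat τ X) 1 := by
  intro s
  simp only [heat]
  congr 1
  funext y
  rw [show s + 1 - y = s - y + 1 by ring, hX]

theorem heat_lipschitz {τ : ℝ} {X : ℝ → E d} {K : NNReal} (hX : Function.Periodic X 1)
    (hL : LipschitzWith K X) : LipschitzWith K (heat τ X) := by
  obtain ⟨C, hC⟩ := exists_bound_of_periodic hX hL.continuous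
  have hint := fun s => integrable_comp_sub_of_bounded
    (μ := gaussianReal 0 (2 * τ).toNNReal) hL.continuous.stronglyMeasurable hC s
  refine LipschitzWith.of_dist_le_mul fun a b => ?_
  rw [dist_eq_norm, heat, heat, ← integral_sub (hint a) (hint b)]
  refine (norm_integral_le_of_norm_le_const (C := K * dist a b)
    (Filter.Eventually.of_forall fun y => ?_)).trans (by simp)
  rw [← dist_eq_norm]
  simpa using hL.dist_le_mul (a - y) (b - y)

theorem repr_heat {τ : ℝ} {X : ℝ → E d} (hX : Function.Periodic X 1) (hc : Continuous X)
    (b : OrthonormalBasis (Fin d) ℝ (E d)) (i : Fin d) (s : ℝ) :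
    b.repr (heat τ X s) i = heatR τ (fun r => b.repr (X r) i) s := by
  obtain ⟨C, hC⟩ := exists_bound_of_periodic hX hc
  have hint := integrable_comp_sub_of_bounded
    (μ := gaussianReal 0 (2 * τ).toNNReal) hc.stronglyMeasurable hC s
  simp only [b.repr_apply_apply, heat, heatR]
  exact (integral_inner hint (b i)).symm

theorem heat_zero (X : ℝ → E d) : heat 0 X = X := by
  funext s
  simp [heat]

/-- Variances add when centred Gaussian laws are convolved. -/
theorem heat_heat {σ τ : ℝ} (hσ : 0 ≤ σ) (hτ : 0 ≤ τ) {X : ℝ → E d}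
    (hX : Function.Periodic X 1) (hc : Continuous X) :
    heat σ (heat τ X) = heat (σ + τ) X := by
  obtain ⟨C, hC⟩ := exists_bound_of_periodic hX hc
  funext s
  simp only [heat]
  have h1 : gaussianReal 0 (2 * (σ + τ)).toNNReal =
      (gaussianReal 0 (2 * σ).toNNReal).conv (gaussianReal 0 (2 * τ).toNNReal) := by
    rw [gaussianReal_conv_gaussianReal, ← Real.toNNReal_add (by positivity) (by positivity)]
    simp [mul_add]
  have h2 : Integrable (fun y => X (s - y))
      ((gaussianReal 0 (2 * σ).toNNReal).conv (gaussianReal 0 (2 * τ).toNNReal)) :=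
    integrable_comp_sub_of_bounded hc.stronglyMeasurable hC s
  rw [h1, integral_conv h2]
  congr 1
  funext y
  congr 1
  funext z
  rw [sub_sub]

end Vector

/-! ### Random walk approximation of the Gaussian. -/

/-- The exponent `n log (1 + y)` is squeezed between `n y / (1 + y)` and `n y`. -/
theorem tendsto_pow_exp_of_tendsto_mul {y : ℕ → ℝ} {n : ℕ → ℕ} {t : ℝ}
    (hy : Tendsto y atTop (𝓝 0)) (hn : Tendsto (fun M => (n M : ℝ) * y M) atTop (𝓝 t)) :
    Tendsto (fun M => (1 + y M) ^ n M) atTop (𝓝 (Real.exp t)) := by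
  have hpos : ∀ᶠ M in atTop, 0 < 1 + y M := by
    have : Tendsto (fun M => 1 + y M) atTop (𝓝 (1 + 0)) := tendsto_const_nhds.add hy
    exact this.eventually (lt_mem_nhds (by norm_num))
  have hlow : Tendsto (fun M => (n M : ℝ) * y M * (1 + y M)⁻¹) atTop (𝓝 t) := by
    have : Tendsto (fun M => (n M : ℝ) * y M * (1 + y M)⁻¹) atTop (𝓝 (t * (1 + 0)⁻¹)) :=
      hn.mul ((tendsto_const_nhds.add hy).inv₀ (by norm_num))
    simpa using this
  have hlog : Tendsto (fun M => (n M : ℝ) * Real.log (1 + y M)) atTop (𝓝 t) := by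
    refine tendsto_of_tendsto_of_tendsto_of_le_of_le' hlow hn ?_ ?_
    · filter_upwards [hpos] with M hM
      have := Real.one_sub_inv_le_log_of_pos hM
      rw [mul_assoc]
      refine mul_le_mul_of_nonneg_left (le_trans (le_of_eq ?_) this) (Nat.cast_nonneg _)
      field_simp
      ring
    · filter_upwards [hpos] with M hM
      refine mul_le_mul_of_nonneg_left ?_ (Nat.cast_nonneg _)
      linarith [Real.log_le_sub_one_of_pos hM]
  refine ((Real.continuous_exp.tendsto t).comp hlog).congr' ?_
  filter_upwards [hpos] with M hM
  rw [Function.comp_apply, Real.exp_nat_mul, Real.exp_log hM]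

/-- The law of a symmetric step of size `h / 2`. -/
noncomputable def coin (h : ℝ) : Measure ℝ :=
  (2⁻¹ : ENNReal) • (Measure.dirac (h / 2) + Measure.dirac (-(h / 2)))

instance (h : ℝ) : IsProbabilityMeasure (coin h) := by
  constructor
  simp only [coin, Measure.smul_apply, Measure.add_apply, measure_univ, smul_eq_mul]
  rw [one_add_one_eq_two]
  exact ENNReal.inv_mul_cancel (by norm_num) (by norm_num)

theorem integral_coin {F : Type*} [NormedAddCommGroup F] [NormedSpace ℝ F] [CompleteSpace F]
    (h : ℝ) (φ : ℝ → F) :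
    ∫ y, φ y ∂coin h = (2⁻¹ : ℝ) • (φ (h / 2) + φ (-(h / 2))) := by
  rw [coin, integral_smul_measure, integral_add_measure, integral_dirac, integral_dirac]
  · simp
  · exact integrable_dirac (by simp)
  · exact integrable_dirac (by simp)

/-- The law of the symmetric random walk of `n` steps of size `h / 2`. -/
noncomputable def walkLaw (h : ℝ) : ℕ → Measure ℝ
  | 0 => Measure.dirac 0
  | n + 1 => (walkLaw h n).conv (coin h)

instance (h : ℝ) (n : ℕ) : IsProbabilityMeasure (walkLaw h n) := by
  induction n with
  | zero => simp only [walkLaw]; infer_instance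
  | succ n ih => simp only [walkLaw]; infer_instance

theorem walkStep_iterate_eq_integral {h : ℝ} {f : ℝ → ℝ} {C : ℝ} (hf : Continuous f)
    (hb : ∀ x, ‖f x‖ ≤ C) (n : ℕ) (s : ℝ) :
    (walkStep h)^[n] f s = ∫ y, f (s - y) ∂walkLaw h n := by
  induction n generalizing f s with
  | zero => simp [walkLaw]
  | succ n ih =>
    have hc : Continuous (walkStep h f) := by
      unfold walkStep
      fun_prop
    have hb' : ∀ x, ‖walkStep h f x‖ ≤ C := by
      intro x
      have h1 := abs_le.1 (hb (x - h / 2))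
      have h2 := abs_le.1 (hb (x + h / 2))
      rw [Real.norm_eq_abs, walkStep, abs_le]
      constructor <;> linarith [h1.1, h1.2, h2.1, h2.2]
    rw [Function.iterate_succ_apply, ih hc hb', walkLaw,
      integral_conv (integrable_comp_sub_of_bounded hf.stronglyMeasurable hb s)]
    congr 1
    funext y
    rw [integral_coin, walkStep, smul_eq_mul, ← sub_sub, ← sub_sub, sub_neg_eq_add]
    ring

theorem charFun_coin (h t : ℝ) : charFun (coin h) t = Real.cos (t * (h / 2)) := by
  rw [charFun_apply_real, integral_coin]
  rw [Complex.ofReal_cos, Complex.cos, Complex.real_smul]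
  push_cast
  ring_nf

theorem charFun_walkLaw (h t : ℝ) (n : ℕ) :
    charFun (walkLaw h n) t = (Real.cos (t * (h / 2)) : ℂ) ^ n := by
  induction n with
  | zero => simp [walkLaw, charFun_dirac]
  | succ n ih => rw [walkLaw, charFun_conv, ih, charFun_coin, pow_succ]

/-- The number of steps of span `1 / M` that produces the variance `2τ`. -/
noncomputable def walkLength (τ : ℝ) (M : ℕ) : ℕ := ⌊8 * τ * (M : ℝ) ^ 2⌋₊

/-- A jump of `±1 / (2M)` has variance `1 / (4M²)`, whence about `8τM²` jumps for the variance `2τ`.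
The characteristic function of one jump is `cos (t / (2M))`, close to `1 - t² / (8M²)`, and its
power tends to `exp (-τt²)`. -/
theorem tendsto_charFun_walkLaw {τ : ℝ} (hτ : 0 < τ) (t : ℝ) :
    Tendsto (fun M : ℕ => charFun (walkLaw (1 / (M : ℝ)) (walkLength τ M)) t) atTop
      (𝓝 (charFun (gaussianReal 0 (2 * τ).toNNReal) t)) := by
  have hinv : Tendsto (fun M : ℕ => t * (1 / (M : ℝ) / 2)) atTop (𝓝 0) := by
    have := (tendsto_one_div_atTop_nhds_zero_nat (𝕜 := ℝ)).div_const 2 |>.const_mul t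
    simpa using this
  have hy : Tendsto (fun M : ℕ => Real.cos (t * (1 / (M : ℝ) / 2)) - 1) atTop (𝓝 0) := by
    have := ((Real.continuous_cos.tendsto 0).comp hinv).sub_const 1
    simpa using this
  have hn : Tendsto (fun M : ℕ => (walkLength τ M : ℝ) / (M : ℝ) ^ 2) atTop (𝓝 (8 * τ)) := by
    have h1 := tendsto_nat_floor_mul_div_atTop (R := ℝ) (a := 8 * τ) (by positivity)
    exact h1.comp ((tendsto_pow_atTop two_ne_zero).comp tendsto_natCast_atTop_atTop)
  have hcos : Tendsto (fun M : ℕ => (M : ℝ) ^ 2 * (Real.cos (t * (1 / (M : ℝ) / 2)) - 1)) atTop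
      (𝓝 (- (t ^ 2 / 8))) := by
    -- By the half-angle formula the quantity equals `-(t² / 8) sinc² (t / (4M))`, and `sinc` is
    -- continuous at zero.
    have hsinc : Tendsto (fun M : ℕ => - (t ^ 2 / 8) * Real.sinc (t * (1 / (M : ℝ) / 4)) ^ 2) atTop
        (𝓝 (- (t ^ 2 / 8) * Real.sinc 0 ^ 2)) := by
      have : Tendsto (fun M : ℕ => t * (1 / (M : ℝ) / 4)) atTop (𝓝 0) := by
        have := (tendsto_one_div_atTop_nhds_zero_nat (𝕜 := ℝ)).div_const 4 |>.const_mul t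
        simpa using this
      exact (((Real.continuous_sinc.tendsto 0).comp this).pow 2).const_mul _
    rw [Real.sinc_zero, one_pow, mul_one] at hsinc
    refine hsinc.congr' ?_
    filter_upwards [eventually_gt_atTop 0] with M hM
    have hM' : (M : ℝ) ≠ 0 := by positivity
    have h2 : t * (1 / (M : ℝ) / 2) = 2 * (t * (1 / (M : ℝ) / 4)) := by ring
    rw [h2, Real.cos_two_mul, Real.cos_sq']
    rcases eq_or_ne t 0 with rfl | ht
    · norm_num
    · rw [Real.sinc_of_ne_zero (by positivity)]
      field_simp
      ring
  have hprod : Tendsto (fun M : ℕ => (walkLength τ M : ℝ) * (Real.cos (t * (1 / (M : ℝ) / 2)) - 1))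
      atTop (𝓝 (-(τ * t ^ 2))) := by
    have := hn.mul hcos
    rw [show 8 * τ * -(t ^ 2 / 8) = -(τ * t ^ 2) by ring] at this
    refine this.congr' ?_
    filter_upwards [eventually_gt_atTop 0] with M hM
    have hM' : (M : ℝ) ≠ 0 := by positivity
    field_simp
  have hlim := tendsto_pow_exp_of_tendsto_mul hy hprod
  rw [charFun_gaussianReal]
  have hval : Complex.exp (t * ((0 : ℝ) : ℂ) * Complex.I -
      (((2 * τ).toNNReal : NNReal) : ℂ) * (t : ℂ) ^ 2 / 2) = (Real.exp (-(τ * t ^ 2)) : ℂ) := by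
    have : (((2 * τ).toNNReal : NNReal) : ℂ) = ((2 * τ : ℝ) : ℂ) := by
      exact congrArg Complex.ofReal (Real.coe_toNNReal (2 * τ) (by positivity))
    rw [this]
    push_cast
    congr 1
    ring
  rw [hval]
  refine ((Complex.continuous_ofReal.tendsto _).comp hlim).congr fun M => ?_
  rw [charFun_walkLaw, Function.comp_apply, add_sub_cancel]
  push_cast
  rfl

/-- Lévy's continuity theorem gives weak convergence of the laws, which is tested on the bounded
continuous function `y ↦ f (s - y)`. -/
theorem tendsto_walkStep_iterate {τ : ℝ} (hτ : 0 < τ) {f : ℝ → ℝ} {C : ℝ} (hf : Continuous f)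
    (hb : ∀ x, ‖f x‖ ≤ C) (s : ℝ) :
    Tendsto (fun M : ℕ => (walkStep (1 / (M : ℝ)))^[walkLength τ M] f s) atTop
      (𝓝 (heatR τ f s)) := by
  let μ : ℕ → ProbabilityMeasure ℝ := fun M =>
    ⟨walkLaw (1 / (M : ℝ)) (walkLength τ M), inferInstance⟩
  let ν : ProbabilityMeasure ℝ := ⟨gaussianReal 0 (2 * τ).toNNReal, inferInstance⟩
  have h1 : Tendsto μ atTop (𝓝 ν) :=
    ProbabilityMeasure.tendsto_iff_tendsto_charFun.2 (tendsto_charFun_walkLaw hτ)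
  have h2 := ProbabilityMeasure.tendsto_iff_forall_integral_tendsto.1 h1
    (BoundedContinuousFunction.ofNormedAddCommGroup (fun y => f (s - y)) (by fun_prop) C
      fun y => hb _)
  refine h2.congr fun M => ?_
  rw [walkStep_iterate_eq_integral hf hb]
  rfl

theorem lipschitzWith_walkStep_iterate {h : ℝ} {f : ℝ → ℝ} {K : NNReal} (hf : LipschitzWith K f)
    (n : ℕ) : LipschitzWith K ((walkStep h)^[n] f) := by
  induction n generalizing f with
  | zero => exact hf
  | succ n ih =>
    refine ih (LipschitzWith.of_dist_le_mul fun a b => ?_)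
    have h1 := hf.dist_le_mul (a - h / 2) (b - h / 2)
    have h2 := hf.dist_le_mul (a + h / 2) (b + h / 2)
    rw [Real.dist_eq, Real.dist_eq] at *
    rw [sub_sub_sub_cancel_right] at h1
    rw [add_sub_add_right_eq_sub] at h2
    simp only [walkStep]
    have h3 := abs_le.1 h1
    have h4 := abs_le.1 h2
    rw [abs_le]
    constructor <;> linarith [h3.1, h3.2, h4.1, h4.2]

/-- Sign changes are followed only along the grid, so the evaluation point must be a grid point.
Moving it costs at most `K / M`, because the Lipschitz constant does not depend on the number of
steps. -/
theorem tendsto_walkStep_iterate_floor {τ : ℝ} (hτ : 0 < τ) {f : ℝ → ℝ} {K : NNReal} {C : ℝ}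
    (hf : LipschitzWith K f) (hb : ∀ x, ‖f x‖ ≤ C) (s : ℝ) :
    Tendsto (fun M : ℕ => (walkStep (1 / (M : ℝ)))^[walkLength τ M] f
      ((⌊M * s⌋ : ℝ) * (1 / (M : ℝ)))) atTop (𝓝 (heatR τ f s)) := by
  have h1 := tendsto_walkStep_iterate hτ hf.continuous hb s
  refine h1.congr_dist ?_
  have h2 : Tendsto (fun M : ℕ => (K : ℝ) * (1 / (M : ℝ))) atTop (𝓝 0) := by
    simpa using (tendsto_one_div_atTop_nhds_zero_nat (𝕜 := ℝ)).const_mul (K : ℝ)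
  refine squeeze_zero' (Eventually.of_forall fun _ => dist_nonneg) ?_ h2
  filter_upwards [eventually_gt_atTop 0] with M hM
  have hM' : (0 : ℝ) < M := by positivity
  refine ((lipschitzWith_walkStep_iterate hf _).dist_le_mul _ _).trans
    (mul_le_mul_of_nonneg_left ?_ K.2)
  rw [Real.dist_eq, show s - (⌊M * s⌋ : ℝ) * (1 / (M : ℝ)) = (M * s - ⌊M * s⌋) * (1 / (M : ℝ)) by
    field_simp, abs_mul, abs_of_nonneg (sub_nonneg.2 (Int.floor_le _)),
    abs_of_pos (by positivity)]
  have := (Int.lt_floor_add_one (M * s)).le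
  refine mul_le_of_le_one_left (by positivity) (by linarith)

/-! ### Strict sign changes under the heat flow. -/

theorem exists_pos_of_integral_pos {g : ℝ → ℝ} {a b : ℝ} (hab : a ≤ b)
    (h : 0 < ∫ x in a..b, g x) : ∃ r ∈ Ioc a b, 0 < g r := by
  by_contra hcon
  push Not at hcon
  rw [intervalIntegral.integral_of_le hab] at h
  exact absurd h (not_lt.2 (setIntegral_nonpos measurableSet_Ioc hcon))

theorem exists_step_pos {x : ℤ → ℝ} {a b : ℤ} (hab : a ≤ b) (h : x a < x b) :
    ∃ i, a ≤ i ∧ i < b ∧ x i < x (i + 1) := by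
  by_contra hcon
  push Not at hcon
  have : x b ≤ x a := by
    have key : ∀ n, a ≤ n → n ≤ b → x n ≤ x a := by
      intro n hn
      induction n, hn using Int.leInduction with
      | base => intro _; exact le_rfl
      | succ n hn ih => intro hb; exact (hcon n hn (by omega)).trans (ih (by omega))
    exact key b hab le_rfl
  linarith

/-- If the derivative of the heat evolution of `f` alternates at `q` points of a period, so does
the derivative of `f`. -/
theorem Alternates.of_heatR {τ : ℝ} (hτ : 0 < τ) {f g : ℝ → ℝ} {K : NNReal} {q : ℕ}
    (hf : LipschitzWith K f) (hper : Function.Periodic f 1)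
    (hg : ∀ a b, f b - f a = ∫ x in a..b, g x) 
    (hq : Even q) {D : ℝ → ℝ} (hD : ∀ x, HasDerivAt (heatR τ f) (D x) x)
    (H : Alternates D 1 q) : Alternates g 1 q := by
  rcases Nat.eq_zero_or_pos q with rfl | hq0
  -- With `q = 0` the closing condition reads `x 0 = x 0 + 1`.
  · obtain ⟨x, -, h, -⟩ := H
    simp at h
  obtain ⟨x, hx, hxq, hs⟩ := H
  obtain ⟨C, hC⟩ := exists_bound_of_periodic hper hf.continuous
  -- Each sign of the derivative is turned into a strict inequality between two values of the
  -- evolution. These finitely many inequalities survive for a fine enough random walk.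
  have hex : ∀ j, ∃ t, j < q → t ∈ Ioo (x j) (x (j + 1)) ∧
      (-1) ^ j * heatR τ f (x j) < (-1) ^ j * heatR τ f t := by
    intro j
    by_cases hj : j < q
    · obtain ⟨t, ht1, ht2⟩ := exists_gt_of_hasDerivAt_pos
        ((hD (x j)).const_mul ((-1 : ℝ) ^ j)) (hs j hj) (hx j hj)
      exact ⟨t, fun _ => ⟨ht1, ht2⟩⟩
    · exact ⟨0, fun h => absurd h hj⟩
  choose t ht using hex
  have hev : ∀ᶠ M : ℕ in atTop, ∀ j ∈ Finset.range q,
      (-1) ^ j * (walkStep (1 / (M : ℝ)))^[walkLength τ M] f ((⌊M * x j⌋ : ℝ) * (1 / (M : ℝ))) <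
      (-1) ^ j * (walkStep (1 / (M : ℝ)))^[walkLength τ M] f ((⌊M * t j⌋ : ℝ) * (1 / (M : ℝ))) := by
    refine (Finset.eventually_all _).2 fun j hj => ?_
    exact ((tendsto_walkStep_iterate_floor hτ hf hC (x j)).const_mul _).eventually_lt
      ((tendsto_walkStep_iterate_floor hτ hf hC (t j)).const_mul _)
      (ht j (Finset.mem_range.1 hj)).2
  obtain ⟨M, hM, hM0⟩ := (hev.and (eventually_gt_atTop 0)).exists
  have hM1 : (0 : ℝ) < M := by positivity
  set h : ℝ := 1 / (M : ℝ) with hh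
  have hMh : (M : ℝ) * h = 1 := by rw [hh]; field_simp
  have hh0 : 0 < h := by positivity
  set u := (walkStep h)^[walkLength τ M] f with hu
  have hstep : ∀ j, ∃ i : ℤ, j < q → ⌊M * x j⌋ ≤ i ∧ i < ⌊M * t j⌋ ∧
      0 < (-1) ^ j * gridDiff h 0 u i := by
    intro j
    by_cases hj : j < q
    · obtain ⟨i, h1, h2, h3⟩ := exists_step_pos (x := fun i : ℤ => (-1) ^ j * u ((i : ℝ) * h))
        (Int.floor_le_floor (mul_le_mul_of_nonneg_left (ht j hj).1.1.le hM1.le))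
        (hM j (Finset.mem_range.2 hj))
      refine ⟨i, fun _ => ⟨h1, h2, ?_⟩⟩
      simp only [gridDiff, zero_add]
      push_cast at h3
      linarith
    · exact ⟨0, fun h => absurd h hj⟩
  choose i hi using hstep
  have hti : ∀ j, j < q → ⌊M * t j⌋ ≤ ⌊M * x (j + 1)⌋ := fun j hj =>
    Int.floor_le_floor (mul_le_mul_of_nonneg_left (ht j hj).1.2.le hM1.le)
  -- Only the indices below `q` were chosen; the closing one has to be the translate of the first by
  -- a full period of `M` cells.
  have hgrid : Alternates (gridDiff h 0 u) (M : ℤ) q := by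
    refine ⟨fun j => if j < q then i j else i 0 + M, fun j hj => ?_, ?_, fun j hj => ?_⟩
    · simp only [if_pos hj]
      have h1 := (hi j hj).2.1
      have h2 := hti j hj
      split_ifs with hj'
      · have h3 := (hi (j + 1) hj').1
        omega
      · have hjq : j + 1 = q := by omega
        have h3 := (hi 0 hq0).1
        rw [hjq, hxq, mul_add, mul_one, Int.floor_add_natCast] at h2
        omega
    · simp [hq0]
    · simp only [if_pos hj]
      exact (hi j hj).2.2
  obtain ⟨c, k, hk, hkq, hks⟩ := Alternates.of_walkStep_iterate hper hMh hq _ _ hgrid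
  -- An increment of `f` is the integral of `g` over a cell, so `g` takes its sign somewhere in the
  -- cell. Half-open cells keep points of adjacent cells strictly ordered.
  have hr : ∀ j, ∃ r, j < q → r ∈ Ioc (c + k j * h) (c + (k j + 1) * h) ∧ 0 < (-1) ^ j * g r := by
    intro j
    by_cases hj : j < q
    · have h1 := hks j hj
      rw [gridDiff, hg, ← intervalIntegral.integral_const_mul] at h1
      obtain ⟨r, hr1, hr2⟩ := exists_pos_of_integral_pos (by linarith) h1
      exact ⟨r, fun _ => ⟨hr1, hr2⟩⟩
    · exact ⟨0, fun h => absurd h hj⟩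
  choose r hr using hr
  refine ⟨fun j => if j < q then r j else r 0 + 1, fun j hj => ?_, ?_, fun j hj => ?_⟩
  · simp only [if_pos hj]
    have h1 := (hr j hj).1.2
    have h2 : ((k j : ℝ) + 1) * h ≤ (k (j + 1) : ℝ) * h :=
      mul_le_mul_of_nonneg_right (by exact_mod_cast Int.add_one_le_of_lt (hk j hj)) hh0.le
    split_ifs with hj'
    · have h3 := (hr (j + 1) hj').1.1
      linarith
    · have hjq : j + 1 = q := by omega
      have h3 := (hr 0 hq0).1.1
      have h4 : (k q : ℝ) = k 0 + M := by exact_mod_cast congrArg (Int.cast : ℤ → ℝ) hkq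
      have h5 : ((k 0 : ℝ) + M) * h = k 0 * h + 1 := by linear_combination hMh
      rw [hjq, h4, h5] at h2
      linarith
  · simp [hq0]
  · simp only [if_pos hj]
    exact (hr j hj).2

/-! ### The heat kernel of the circle and independence of its translates. -/

/-- The heat kernel of the circle: the periodization of the centred Gaussian density of
variance `v`. -/
noncomputable def circleKernel (v : ℝ≥0) (z : ℝ) : ℝ := ∑' n : ℤ, gaussianPDFReal 0 v (z - n)

theorem summable_exp_neg_mul_abs_int {c : ℝ} (hc : 0 < c) :
    Summable fun n : ℤ => Real.exp (-(c * |(n : ℝ)|)) := by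
  have h : Summable fun n : ℕ => Real.exp (-(c * |(n : ℝ)|)) := by
    refine (Real.summable_exp_nat_mul_iff (a := -c)).2 (by linarith) |>.congr fun n => ?_
    rw [abs_of_nonneg (Nat.cast_nonneg n)]
    ring_nf
  refine Summable.of_nat_of_neg ?_ ?_
  · simpa using h
  · simpa using h

/-- A summable bound, uniform for `|z| ≤ R`, which justifies continuity of the periodized kernel and
the exchange of sum and integral. It rests on `|n| ≤ n² ≤ 2z² + 2(z - n)²`. -/
theorem gaussianPDFReal_sub_int_le {v : ℝ≥0} (hv : v ≠ 0) {R z : ℝ} (hz : |z| ≤ R) (n : ℤ) :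
    ‖gaussianPDFReal 0 v (z - n)‖ ≤
      (√(2 * Real.pi * v))⁻¹ * Real.exp (R ^ 2 / (2 * v)) *
        Real.exp (-((4 * (v : ℝ))⁻¹ * |(n : ℝ)|)) := by
  have hv' : (0 : ℝ) < v := NNReal.coe_pos.2 (pos_iff_ne_zero.2 hv)
  rw [Real.norm_of_nonneg (gaussianPDFReal_nonneg _ _ _), gaussianPDFReal,
    mul_assoc _⁻¹ (Real.exp _), ← Real.exp_add]
  refine mul_le_mul_of_nonneg_left (Real.exp_le_exp.2 ?_) (by positivity)
  have h1 : |(n : ℝ)| ≤ (n : ℝ) ^ 2 := by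
    rw [← sq_abs]
    have : |n| ≤ |n| ^ 2 := by
      rcases eq_or_ne n 0 with rfl | hn
      · simp
      · nlinarith [Int.one_le_abs hn]
    exact_mod_cast this
  have h2 : z ^ 2 ≤ R ^ 2 := sq_le_sq' (by linarith [(abs_le.1 hz).1]) (abs_le.1 hz).2
  rw [sub_zero, ← sub_nonneg]
  have h3 : R ^ 2 / (2 * (v : ℝ)) + -((4 * (v : ℝ))⁻¹ * |(n : ℝ)|) - -(z - n) ^ 2 / (2 * v) =
      (2 * R ^ 2 - |(n : ℝ)| + 2 * (z - n) ^ 2) / (4 * v) := by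
    field_simp
    ring
  rw [h3]
  refine div_nonneg ?_ (by positivity)
  nlinarith [sq_nonneg (2 * z - n)]

theorem summable_circleKernel {v : ℝ≥0} (hv : v ≠ 0) (z : ℝ) :
    Summable fun n : ℤ => gaussianPDFReal 0 v (z - n) :=
  Summable.of_norm_bounded ((summable_exp_neg_mul_abs_int (by positivity)).mul_left _)
    (gaussianPDFReal_sub_int_le hv le_rfl)

theorem circleKernel_continuous {v : ℝ≥0} (hv : v ≠ 0) : Continuous (circleKernel v) := by
  refine continuous_iff_continuousAt.2 fun z => ?_
  have h : ContinuousOn (circleKernel v) (Icc (-(|z| + 1)) (|z| + 1)) := by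
    refine continuousOn_tsum (fun n => ?_)
      ((summable_exp_neg_mul_abs_int (c := (4 * (v : ℝ))⁻¹) (by positivity)).mul_left
        ((√(2 * Real.pi * v))⁻¹ * Real.exp ((|z| + 1) ^ 2 / (2 * v))))
      fun n x hx => gaussianPDFReal_sub_int_le hv (abs_le.2 hx) n
    unfold gaussianPDFReal
    fun_prop
  refine h.continuousAt (Icc_mem_nhds ?_ ?_)
  · linarith [neg_abs_le z]
  · linarith [le_abs_self z]

theorem circleKernel_periodic (v : ℝ≥0) : Function.Periodic (circleKernel v) 1 := by
  intro z
  rw [circleKernel, circleKernel, ← (Equiv.addRight (1 : ℤ)).tsum_eq]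
  congr 1
  funext n
  simp

/-- The heat evolution of a periodic function is its convolution on the circle with the periodized
kernel. -/
theorem integral_gaussianReal_eq_circle {F : Type*} [NormedAddCommGroup F] [NormedSpace ℝ F]
    [CompleteSpace F] {v : ℝ≥0} (hv : v ≠ 0) {φ : ℝ → F} {C : ℝ} (hm : StronglyMeasurable φ)
    (hb : ∀ x, ‖φ x‖ ≤ C) (hper : Function.Periodic φ 1) (s : ℝ) :
    ∫ y, φ (s - y) ∂(gaussianReal 0 v) = ∫ y in (0 : ℝ)..1, circleKernel v (s - y) • φ y := by
  have hint0 : Integrable fun y => gaussianPDFReal 0 v (s - y) :=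
    (integrable_gaussianPDFReal 0 v).comp_sub_left s
  have hint : Integrable fun y => gaussianPDFReal 0 v (s - y) • φ y :=
    hint0.smul_bdd C hm.aestronglyMeasurable (Eventually.of_forall hb)
  have h1 : ∫ y, φ (s - y) ∂(gaussianReal 0 v) = ∫ y, gaussianPDFReal 0 v (s - y) • φ y := by
    rw [integral_gaussianReal_eq_integral_smul hv,
      ← integral_sub_left_eq_self (fun y => gaussianPDFReal 0 v (s - y) • φ y) volume s]
    simp
  have h2 := hint.hasSum_intervalIntegral_comp_add_int
  rw [h1]
  refine h2.unique ?_
  have hsum := summable_exp_neg_mul_abs_int (c := (4 * (v : ℝ))⁻¹)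
    (by have := NNReal.coe_pos.2 (pos_iff_ne_zero.2 hv); positivity)
  set A : ℝ := (√(2 * Real.pi * v))⁻¹ * Real.exp ((|s| + 1) ^ 2 / (2 * v)) with hA
  refine intervalIntegral.hasSum_integral_of_dominated_convergence
    (fun n _ => A * Real.exp (-((4 * (v : ℝ))⁻¹ * |(n : ℝ)|)) * C) (fun n => ?_) (fun n => ?_)
    ?_ ?_ ?_
  · have h3 : Measurable fun x : ℝ => gaussianPDFReal 0 v (s - (x + n)) :=
      (measurable_gaussianPDFReal 0 v).comp (by fun_prop)
    exact (h3.stronglyMeasurable.smul (hm.comp_measurable (by fun_prop))).aestronglyMeasurable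
  · refine Eventually.of_forall fun y hy => ?_
    rw [uIoc_of_le zero_le_one] at hy
    rw [norm_smul, ← sub_sub]
    refine mul_le_mul (gaussianPDFReal_sub_int_le hv ?_ n) (hb _) (norm_nonneg _) (by positivity)
    refine (abs_sub s y).trans ?_
    rw [abs_of_pos hy.1]
    linarith [hy.2]
  · exact Eventually.of_forall fun y _ => (hsum.mul_left A).mul_right C
  · exact intervalIntegrable_const
  · refine Eventually.of_forall fun y _ => ?_
    have h3 : ∀ n : ℤ, φ (y + n) = φ y := fun n => by simpa using hper.int_mul n y
    simp only [h3, ← sub_sub]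
    exact (summable_circleKernel hv (s - y)).hasSum.smul_const (φ y)

/-- Translates of the circle kernel at distinct points of the circle and the constant function are
linearly independent. -/
theorem circleKernel_independent {v : ℝ≥0} (hv : v ≠ 0) {q : ℕ} {x : Fin q → ℝ}
    (hx : Function.Injective fun j => Complex.exp (2 * Real.pi * Complex.I * x j))
    (c : Fin q → ℝ) (a : ℝ)
    (h : ∀ y ∈ Ioo (0 : ℝ) 1, ∑ j, c j * circleKernel v (x j - y) + a = 0) : c = 0 ∧ a = 0 := by
  have hker := circleKernel_continuous hv
  have hc : c = 0 := by
    -- The relation is integrated against exponentials, which are eigenfunctions of the heat flow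
    -- with nonzero eigenvalues. This gives a Vandermonde system for the `c j`, up to nonzero
    -- factors.
    have hpow : ∀ i : Fin q, ∑ j, ((c j : ℂ) * Complex.exp (2 * Real.pi * Complex.I * x j)) *
        (Complex.exp (2 * Real.pi * Complex.I * x j)) ^ (i : ℕ) = 0 := by
      intro i
      -- Frequency zero is skipped so that the constant `a` integrates to zero; the extra power of
      -- the exponential is absorbed in the unknown coefficient.
      set m : ℕ := i + 1 with hm
      set e : ℝ → ℂ := fun y => Complex.exp (2 * Real.pi * Complex.I * m * y) with he
      have hecont : Continuous e := by fun_prop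
      have henorm : ∀ y, ‖e y‖ ≤ 1 := by
        intro y
        change ‖Complex.exp _‖ ≤ 1
        rw [show 2 * (Real.pi : ℂ) * Complex.I * m * y = ((2 * Real.pi * m * y : ℝ) : ℂ) *
          Complex.I by push_cast; ring, Complex.norm_exp_ofReal_mul_I]
      have heper : Function.Periodic e 1 := by
        intro y
        simp only [he]
        rw [← Complex.exp_periodic.nat_mul m (2 * Real.pi * Complex.I * m * y)]
        congr 1
        push_cast
        ring
      have hheat : ∀ s, ∫ y in (0 : ℝ)..1, circleKernel v (s - y) • e y =
          e s * charFun (gaussianReal 0 v) (-(2 * Real.pi * m)) := by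
        intro s
        rw [← integral_gaussianReal_eq_circle hv hecont.stronglyMeasurable henorm heper,
          charFun_apply_real, ← integral_const_mul]
        congr 1
        funext y
        simp only [he]
        rw [← Complex.exp_add]
        congr 1
        push_cast
        ring
      have hzero : ∫ y in (0 : ℝ)..1, ((∑ j, c j * circleKernel v (x j - y) + a : ℝ)) • e y = 0 := by
        rw [intervalIntegral.integral_of_le zero_le_one, integral_Ioc_eq_integral_Ioo]
        refine setIntegral_eq_zero_of_forall_eq_zero fun y hy => ?_
        rw [h y hy, zero_smul]
      have hconst : ∫ y in (0 : ℝ)..1, e y = 0 := by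
        have hm0 : (m : ℂ) ≠ 0 := by simp [hm, Nat.cast_add_one_ne_zero]
        have h1 : e 1 = e 0 := by simpa using heper 0
        simp only [he] at h1 ⊢
        rw [integral_exp_mul_complex (mul_ne_zero Complex.two_pi_I_ne_zero hm0), h1, sub_self,
          zero_div]
      have hsplit : ∫ y in (0 : ℝ)..1, ((∑ j, c j * circleKernel v (x j - y) + a : ℝ)) • e y =
          ∑ j, (c j : ℂ) * (e (x j) * charFun (gaussianReal 0 v) (-(2 * Real.pi * m))) := by
        have hint : ∀ j, IntervalIntegrable
            (fun y => (c j : ℂ) * (circleKernel v (x j - y) • e y)) volume 0 1 := fun j =>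
          (Continuous.intervalIntegrable (by fun_prop) 0 1)
        have h4 : ∀ y, (∑ j, c j * circleKernel v (x j - y) + a : ℝ) • e y =
            ∑ j, (c j : ℂ) * (circleKernel v (x j - y) • e y) + (a : ℂ) * e y := by
          intro y
          simp only [Complex.real_smul]
          push_cast
          rw [add_mul, Finset.sum_mul]
          simp only [mul_assoc]
        simp only [h4]
        rw [intervalIntegral.integral_add
            (Continuous.intervalIntegrable (by fun_prop) 0 1)
            (Continuous.intervalIntegrable (by fun_prop) 0 1),
          intervalIntegral.integral_finsetSum fun j _ => hint j,
          intervalIntegral.integral_const_mul, hconst, mul_zero, add_zero]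
        refine Finset.sum_congr rfl fun j _ => ?_
        rw [intervalIntegral.integral_const_mul, hheat]
      have hchar : charFun (gaussianReal 0 v) (-(2 * Real.pi * m)) ≠ 0 := by
        rw [charFun_gaussianReal]
        exact Complex.exp_ne_zero _
      rw [hsplit] at hzero
      have h3 : (∑ j, (c j : ℂ) * e (x j)) * charFun (gaussianReal 0 v) (-(2 * Real.pi * m)) = 0 := by
        rw [Finset.sum_mul, ← hzero]
        exact Finset.sum_congr rfl fun j _ => by ring
      rw [← (mul_eq_zero.1 h3).resolve_right hchar]
      refine Finset.sum_congr rfl fun j _ => ?_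
      simp only [he]
      rw [← Complex.exp_nat_mul, mul_assoc, ← Complex.exp_add, hm]
      congr 2
      push_cast
      ring
    have h0 := Matrix.eq_zero_of_forall_pow_sum_mul_pow_eq_zero hx hpow
    funext j
    have := congrFun h0 j
    simpa [Complex.exp_ne_zero] using this
  refine ⟨hc, ?_⟩
  have := h (1 / 2) ⟨by norm_num, by norm_num⟩
  simpa [hc] using this

/-! ### Prescribing values of the evolution by a bounded factor. -/

/-- Nonsingularity of the Gram matrix of linearly independent continuous functions with respect to
the weight `g²`, for a function `g` that does not vanish on any interval. -/
theorem exists_gram_solution {ι : Type*} [Fintype ι] {w : ι → ℝ → ℝ} (hw : ∀ i, Continuous (w i))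
    {g : ℝ → ℝ} {K : ℝ} (hg : Measurable g) (hb : ∀ x, ‖g x‖ ≤ K)
    (hnz : ∀ a b, a < b → ¬ ∀ᵐ x, x ∈ Ioo a b → g x = 0)
    (hind : ∀ c : ι → ℝ, (∀ y ∈ Ioo (0 : ℝ) 1, ∑ i, c i * w i y = 0) → c = 0) (v : ι → ℝ) :
    ∃ β : ι → ℝ, ∀ i, ∫ y in (0 : ℝ)..1, w i y * ((∑ j, β j * w j y) * g y * g y) = v i := by
  have hint : ∀ u : ℝ → ℝ, Continuous u →
      IntervalIntegrable (fun y => u y * (g y * g y)) volume 0 1 := by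
    intro u hu
    have hgg : IntervalIntegrable (fun y => g y * g y) volume 0 1 :=
      intervalIntegrable_of_bounded (C := K * K) (hg.mul hg).stronglyMeasurable (fun x => by
        rw [Pi.mul_apply, norm_mul]
        exact mul_le_mul (hb x) (hb x) (norm_nonneg _) ((norm_nonneg _).trans (hb x))) 0 1
    exact hgg.continuousOn_mul hu.continuousOn
  let A : Matrix ι ι ℝ := Matrix.of fun i j => ∫ y in (0 : ℝ)..1, w i y * w j y * (g y * g y)
  have hA : ∀ (β : ι → ℝ) (i : ι), (A.mulVec β) i =
      ∫ y in (0 : ℝ)..1, w i y * ((∑ j, β j * w j y) * g y * g y) := by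
    intro β i
    have h1 : ∀ y, w i y * ((∑ j, β j * w j y) * g y * g y) =
        ∑ j, w i y * w j y * (g y * g y) * β j := by
      intro y
      rw [Finset.sum_mul, Finset.sum_mul, Finset.mul_sum]
      exact Finset.sum_congr rfl fun j _ => by ring
    simp only [h1]
    rw [intervalIntegral.integral_finsetSum fun j _ =>
      (hint (fun y => w i y * w j y) ((hw i).mul (hw j))).mul_const (β j)]
    simp only [intervalIntegral.integral_mul_const]
    rfl
  -- For `c` in the kernel, the quadratic form `∫ W²g²` vanishes, so `Wg = 0` almost everywhere. If
  -- the continuous `W` were nonzero at a point of `(0, 1)`, then `g` would vanish almost everywhere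
  -- on an interval around it.
  have hinj : Function.Injective A.mulVecLin := by
    rw [injective_iff_map_eq_zero]
    intro c hc
    set W : ℝ → ℝ := fun y => ∑ j, c j * w j y with hW
    have hWc : Continuous W := by fun_prop
    have h0 : ∫ y in (0 : ℝ)..1, W y * W y * (g y * g y) = 0 := by
      have h1 : ∀ i, ∫ y in (0 : ℝ)..1, c i * (w i y * (W y * g y * g y)) = 0 := by
        intro i
        rw [intervalIntegral.integral_const_mul, ← hA c i]
        have := congrFun hc i
        rw [Matrix.mulVecLin_apply] at this
        rw [this]
        simp
      have h2 : ∀ y, W y * W y * (g y * g y) = ∑ i, c i * (w i y * (W y * g y * g y)) := by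
        intro y
        rw [show W y * W y * (g y * g y) = W y * (W y * g y * g y) by ring]
        nth_rewrite 1 [hW]
        rw [Finset.sum_mul]
        exact Finset.sum_congr rfl fun i _ => by ring
      simp only [h2]
      rw [intervalIntegral.integral_finsetSum, Finset.sum_eq_zero fun i _ => h1 i]
      intro i _
      refine (hint (fun y => c i * w i y * W y) (by fun_prop)).congr ?_
      exact fun y _ => by ring
    have hnn : ∀ y, 0 ≤ W y * W y * (g y * g y) := fun y =>
      mul_nonneg (mul_self_nonneg _) (mul_self_nonneg _)
    have hae := (intervalIntegral.integral_eq_zero_iff_of_le_of_nonneg_ae zero_le_one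
      (Eventually.of_forall hnn) (hint (fun y => W y * W y) (by fun_prop))).1 h0
    refine hind c fun y hy => ?_
    by_contra hne
    have hev : ∀ᶠ z in 𝓝 y, W z ≠ 0 ∧ z ∈ Ioo (0 : ℝ) 1 :=
      (hWc.continuousAt.eventually_ne hne).and (Ioo_mem_nhds hy.1 hy.2)
    obtain ⟨ε, hε, hball⟩ := Metric.eventually_nhds_iff_ball.1 hev
    rw [Real.ball_eq_Ioo] at hball
    refine hnz (y - ε) (y + ε) (by linarith) ?_
    filter_upwards [(ae_restrict_iff' measurableSet_Ioc).1 hae] with z hz hzI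
    obtain ⟨h3, h4⟩ := hball z hzI
    have h5 := hz ⟨h4.1, h4.2.le⟩
    simpa [h3] using h5
  obtain ⟨β, hβ⟩ := LinearMap.injective_iff_surjective.1 hinj v
  refine ⟨β, fun i => ?_⟩
  rw [← hA, ← Matrix.mulVecLin_apply, hβ]

/-- A bounded factor `ψ` can be chosen so that the heat evolution of `ψ g` takes prescribed values
at finitely many points of the circle while the mean of `ψ g` vanishes. -/
theorem exists_factor_heatR_eq {τ : ℝ} (hτ : 0 < τ) {g : ℝ → ℝ} {K : ℝ} (hg : Measurable g)
    (hb : ∀ x, ‖g x‖ ≤ K) (hper : Function.Periodic g 1)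
    (hnz : ∀ a b, a < b → ¬ ∀ᵐ x, x ∈ Ioo a b → g x = 0) {q : ℕ} {x : Fin q → ℝ}
    (hx : Function.Injective fun j => Complex.exp (2 * Real.pi * Complex.I * x j))
    (v : Fin q → ℝ) :
    ∃ (ψ : ℝ → ℝ) (B : ℝ), Measurable ψ ∧ (∀ x, ‖ψ x‖ ≤ B) ∧ Function.Periodic ψ 1 ∧
      ∫ y in (0 : ℝ)..1, ψ y * g y = 0 ∧ ∀ j, heatR τ (fun y => ψ y * g y) (x j) = v j := by
  have hv : (2 * τ).toNNReal ≠ 0 := by simpa using hτ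
  set k := circleKernel (2 * τ).toNNReal with hk
  have hkc : Continuous k := circleKernel_continuous hv
  have hkp : Function.Periodic k 1 := circleKernel_periodic _
  -- The index `none` stands for the condition on the mean, and `some j` for the value of the
  -- evolution at `x j`.
  let w : Option (Fin q) → ℝ → ℝ := fun i y => i.elim 1 fun j => k (x j - y)
  have hw : ∀ i, Continuous (w i) := by
    rintro (_ | j)
    · exact continuous_const
    · change Continuous fun y => k (x j - y)
      fun_prop
  have hwp : ∀ i, Function.Periodic (w i) 1 := by
    rintro (_ | j) y
    · rfl
    · change k (x j - (y + 1)) = k (x j - y)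
      rw [← sub_sub, hkp.sub_eq]
  obtain ⟨β, hβ⟩ := exists_gram_solution hw hg hb hnz (fun c hc => by
    obtain ⟨h1, h2⟩ := circleKernel_independent hv hx (fun j => c (some j)) (c none)
      (fun y hy => by
        have := hc y hy
        rw [Fintype.sum_option] at this
        rw [add_comm]
        simpa [w] using this)
    funext i
    rcases i with _ | j
    · exact h2
    · exact congrFun h1 j) (fun i => i.elim 0 v)
  set W : ℝ → ℝ := fun y => ∑ j, β j * w j y with hW
  have hWc : Continuous W := by fun_prop
  have hWp : Function.Periodic W 1 := fun y => by simp only [hW, hwp _ y]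
  obtain ⟨D, hD⟩ := exists_bound_of_periodic hWp hWc
  have hψb : ∀ y, ‖W y * g y‖ ≤ D * K := fun y => by
    rw [norm_mul]
    exact mul_le_mul (hD y) (hb y) (norm_nonneg _) ((norm_nonneg _).trans (hD y))
  have hψm : Measurable fun y => W y * g y := hWc.measurable.mul hg
  have hψp : Function.Periodic (fun y => W y * g y) 1 := fun y => by simp only [hWp y, hper y]
  -- Taking `ψ` proportional to `g` gives `ψg = Wg²`, so the conditions become a linear system with
  -- a Gram matrix.
  refine ⟨fun y => W y * g y, D * K, hψm, hψb, hψp, ?_, fun j => ?_⟩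
  · have h := hβ none
    change ∫ y in (0 : ℝ)..1, (1 : ℝ) * (W y * g y * g y) = 0 at h
    simpa only [one_mul] using h
  · rw [heatR, integral_gaussianReal_eq_circle hv (C := D * K * K) (φ := fun y => W y * g y * g y)
      (hψm.mul hg).stronglyMeasurable (fun y => ?_) (fun y => by simp only [hWp y, hper y])]
    · exact hβ (some j)
    · rw [norm_mul]
      exact mul_le_mul (hψb y) (hb y) (norm_nonneg _) ((norm_nonneg _).trans (hψb y))

/-! ### From sign changes to zeros: the heat flow does not increase extremities. -/

theorem eq_of_fract_eq_of_abs_sub_lt {x y : ℝ} (h : Int.fract x = Int.fract y)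
    (hxy : |x - y| < 1) : x = y := by
  obtain ⟨z, hz⟩ := Int.fract_eq_fract.1 h
  rw [hz] at hxy
  have : z = 0 := by
    rw [← Int.abs_lt_one_iff]
    exact_mod_cast hxy
  rw [this] at hz
  push_cast at hz
  linarith

/-- A function with finitely many extremity points is not constant on any interval. -/
theorem exists_ne_of_finite_extremities {f : ℝ → ℝ} (hf : Function.Periodic f 1)
    (hfin : (extremities f).Finite) {a b : ℝ} (hab : a < b) : ∃ x ∈ Ioo a b, f x ≠ f ((a + b) / 2)
    := by
  by_contra hcon
  push Not at hcon
  -- On an interval of length at most one `Int.fract` is injective. If `f` were constant there, each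
  -- point would be an extremity, giving infinitely many in one period.
  set b' := min b (a + 1) with hb'
  have hab' : a < b' := lt_min hab (by linarith)
  refine (Ioo_infinite hab').not_finite ?_
  refine Set.Finite.of_finite_image (f := Int.fract) (hfin.subset ?_) ?_
  · rintro _ ⟨r, hr, rfl⟩
    refine fract_mem_extremities hf (Or.inr (Or.inl ?_))
    have hr' : r ∈ Ioo a b := ⟨hr.1, hr.2.trans_le (min_le_left _ _)⟩
    filter_upwards [Ioo_mem_nhds hr'.1 hr'.2] with x hx
    rw [hcon x hx, hcon r hr']
  · intro x hx y hy hxy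
    have h1 : b' ≤ a + 1 := min_le_right _ _
    refine eq_of_fract_eq_of_abs_sub_lt hxy (abs_lt.2 ⟨?_, ?_⟩) <;>
      linarith [hx.1, hx.2, hy.1, hy.2]

theorem not_ae_deriv_eq_zero {f : ℝ → ℝ} {K : ℝ≥0} (hL : LipschitzWith K f)
    (hf : Function.Periodic f 1) (hfin : (extremities f).Finite) (a b : ℝ) (hab : a < b) :
    ¬ ∀ᵐ x, x ∈ Ioo a b → deriv f x = 0 := by
  intro h
  obtain ⟨x, hx, hne⟩ := exists_ne_of_finite_extremities hf hfin hab
  refine hne (sub_eq_zero.1 ?_)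
  rw [← integral_deriv_of_lipschitz hL]
  refine intervalIntegral.integral_zero_ae ?_
  filter_upwards [h] with y hy hyI
  have hm : (a + b) / 2 ∈ Ioo a b := ⟨by linarith, by linarith⟩
  have h1 : y ∈ uIcc ((a + b) / 2) x := uIoc_subset_uIcc hyI
  exact hy (OrdConnected.uIcc_subset ordConnected_Ioo hm hx h1)

theorem heatR_add_const_mul {τ : ℝ} {u w : ℝ → ℝ} {A B : ℝ} (hu : Measurable u)
    (hub : ∀ x, ‖u x‖ ≤ A) (hw : Measurable w) (hwb : ∀ x, ‖w x‖ ≤ B) (ε s : ℝ) :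
    heatR τ (fun y => u y + ε * w y) s = heatR τ u s + ε * heatR τ w s := by
  simp only [heatR]
  rw [integral_add (integrable_comp_sub_of_bounded hu.stronglyMeasurable hub s)
    ((integrable_comp_sub_of_bounded hw.stronglyMeasurable hwb s).const_mul ε),
    integral_const_mul]

/-- If the derivative of the heat evolution of `f` alternates weakly, that is, with zeros counted
with the convenient sign, at `q` points of a period, then the derivative of `f` alternates
strictly. -/
theorem alternates_deriv_of_heatR_weak {τ : ℝ} (hτ : 0 < τ) {f : ℝ → ℝ} {K : ℝ≥0}
    (hL : LipschitzWith K f) (hf : Function.Periodic f 1) (hfin : (extremities f).Finite)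
    {q : ℕ} (hq : Even q) {x : ℕ → ℝ} (hx : ∀ j < q, x j < x (j + 1)) (hxq : x q = x 0 + 1)
    (hs : ∀ j < q, 0 ≤ (-1) ^ j * heatR τ (deriv f) (x j)) : Alternates (deriv f) 1 q := by
  set g := deriv f with hgdef
  have hgm : Measurable g := measurable_deriv f
  have hgb : ∀ x, ‖g x‖ ≤ K := fun _ => norm_deriv_le_of_lipschitz hL
  have hgp : Function.Periodic g 1 := deriv_periodic hf
  have hmono : ∀ i j, i < j → j ≤ q → x i < x j := by
    intro i j hij
    induction j, hij using Nat.le_induction with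
    | base => intro h; exact hx i (by omega)
    | succ j hij ih => intro hj; exact (ih (by omega)).trans (hx j (by omega))
  have hxinj : Function.Injective fun j : Fin q => Complex.exp (2 * Real.pi * Complex.I * x j) := by
    have key : ∀ i j : Fin q, i < j → Complex.exp (2 * Real.pi * Complex.I * x i) ≠
        Complex.exp (2 * Real.pi * Complex.I * x j) := by
      intro i j hij heq
      obtain ⟨n, hn⟩ := Complex.exp_eq_exp_iff_exists_int.1 heq
      have h1 : (x i : ℂ) = x j + n := by
        refine mul_left_cancel₀ Complex.two_pi_I_ne_zero ?_
        rw [hn]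
        ring
      have h2 : x i = x j + n := by exact_mod_cast h1
      have h3 := hmono i j hij j.2.le
      have h4 := hmono j q j.2 le_rfl
      have h5 : x 0 ≤ x i := by
        rcases Nat.eq_zero_or_pos (i : ℕ) with h0 | h0
        · rw [h0]
        · exact (hmono 0 i h0 i.2.le).le
      have h6 : ((-1 : ℤ) : ℝ) < n := by push_cast; linarith
      have h7 : (n : ℝ) < (0 : ℤ) := by push_cast; linarith
      have h8 : -1 < n := by exact_mod_cast h6
      have h9 : n < 0 := by exact_mod_cast h7
      omega
    intro i j hij
    rcases lt_trichotomy i j with h | h | h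
    · exact absurd hij (key i j h)
    · exact h
    · exact absurd hij.symm (key j i h)
  -- The evolution of `ψg` is exactly `(-1) ^ j` at `x j`, so adding a positive multiple of it makes
  -- the weak alternation strict.
  obtain ⟨ψ, B, hψm, hψb, hψp, hψ0, hψx⟩ := exists_factor_heatR_eq hτ hgm hgb hgp
    (not_ae_deriv_eq_zero hL hf hfin) hxinj (fun j => (-1) ^ (j : ℕ))
  have hB : 0 ≤ B := (norm_nonneg _).trans (hψb 0)
  -- This makes `1 + εψ` positive, so the perturbed derivative has the sign of `g` everywhere.
  set ε : ℝ := 1 / (2 * (B + 1)) with hε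
  have hε0 : 0 < ε := by positivity
  have hεψ : ∀ y, |ε * ψ y| < 1 := by
    intro y
    rw [abs_mul, abs_of_pos hε0, hε, div_mul_eq_mul_div, one_mul, div_lt_one (by positivity)]
    have := hψb y
    rw [Real.norm_eq_abs] at this
    linarith
  have hψgm : Measurable fun y => ψ y * g y := hψm.mul hgm
  have hψgb : ∀ y, ‖ψ y * g y‖ ≤ B * K := fun y => by
    rw [norm_mul]
    exact mul_le_mul (hψb y) (hgb y) (norm_nonneg _) hB
  set φ : ℝ → ℝ := fun y => g y + ε * (ψ y * g y) with hφ
  have hφm : Measurable φ := hgm.add (hψgm.const_mul ε)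
  have hφb : ∀ y, ‖φ y‖ ≤ (2 * K : ℝ≥0) := by
    intro y
    have h1 : φ y = (1 + ε * ψ y) * g y := by simp only [hφ]; ring
    rw [h1, norm_mul]
    have h2 := abs_lt.1 (hεψ y)
    push_cast
    refine mul_le_mul ?_ (hgb y) (norm_nonneg _) zero_le_two
    rw [Real.norm_eq_abs, abs_le]
    constructor <;> linarith
  have hφint := intervalIntegrable_of_bounded hφm.stronglyMeasurable hφb
  have hφp : Function.Periodic φ 1 := fun y => by simp only [hφ, hgp y, hψp y]
  -- A vanishing mean is what makes the primitive `F` periodic.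
  have hφ1 : ∫ y in (0 : ℝ)..1, φ y = 0 := by
    simp only [hφ]
    rw [intervalIntegral.integral_add
      (intervalIntegrable_of_bounded hgm.stronglyMeasurable hgb 0 1)
      ((intervalIntegrable_of_bounded hψgm.stronglyMeasurable hψgb 0 1).const_mul ε),
      intervalIntegral.integral_const_mul, hψ0, integral_deriv_of_lipschitz hL]
    have := hf 0
    rw [zero_add] at this
    rw [this]
    ring
  set F : ℝ → ℝ := fun s => ∫ y in (0 : ℝ)..s, φ y with hF
  have hFL : LipschitzWith (2 * K) F :=
    lipschitzWith_integral_of_bounded hφm.stronglyMeasurable hφb 0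
  have hFsub : ∀ a b, F b - F a = ∫ y in a..b, φ y := fun a b =>
    intervalIntegral.integral_interval_sub_left (hφint _ _) (hφint _ _)
  have hFp : Function.Periodic F 1 := by
    intro s
    have h1 := hFsub s (s + 1)
    rw [hφp.intervalIntegral_add_eq s 0, zero_add, hφ1] at h1
    linarith
  obtain ⟨C, hC⟩ := exists_bound_of_periodic hFp hFL.continuous
  have hFd : ∀ᵐ y, HasDerivAt F (φ y) y := by
    filter_upwards [LocallyIntegrable.ae_hasDerivAt_integral
      (locallyIntegrable_of_bounded hφm.stronglyMeasurable hφb)] with y hy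
    exact hy 0
  obtain ⟨k, hk1, hk2, hk3⟩ := Alternates.of_heatR hτ hFL hFp hFsub hq
    (D := heatR τ φ) (fun y => hasDerivAt_heatR hτ hFL hC hφm hFd y)
    ⟨x, hx, hxq, fun j hj => by
      rw [heatR_add_const_mul hgm hgb hψgm hψgb, hψx ⟨j, hj⟩]
      have h1 : ((-1 : ℝ) ^ j) * (ε * (-1) ^ j) = ε := by
        rw [mul_left_comm, ← mul_pow]
        simp
      rw [mul_add, h1]
      linarith [hs j hj]⟩
  refine ⟨k, hk1, hk2, fun j hj => ?_⟩
  have h1 := hk3 j hj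
  rw [show (-1) ^ j * φ (k j) = ((-1) ^ j * g (k j)) * (1 + ε * ψ (k j)) by
    simp only [hφ]; ring] at h1
  exact (mul_pos_iff_of_pos_right (by linarith [(abs_lt.1 (hεψ (k j))).1])).1 h1

theorem extremities_neg (f : ℝ → ℝ) : extremities (-f) = extremities f := by
  have key : ∀ (u : ℝ → ℝ) r, IsExtremity u r → IsExtremity (-u) r := by
    rintro u r (h | h | h)
    · left; simpa using h.neg
    · right; right; exact h.neg
    · right; left; exact h.neg
  ext r
  refine and_congr_right fun _ => ⟨fun h => ?_, key f r⟩
  simpa using key _ r h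

theorem le_encard_extremities_of_heatR_weak {τ : ℝ} (hτ : 0 < τ) {f : ℝ → ℝ} {K : ℝ≥0}
    (hL : LipschitzWith K f) (hf : Function.Periodic f 1) (hfin : (extremities f).Finite)
    {q : ℕ} (hq : Even q) {x : ℕ → ℝ} (hx : ∀ j < q, x j < x (j + 1)) (hxq : x q = x 0 + 1)
    (hs : ∀ j < q, 0 ≤ (-1) ^ j * heatR τ (deriv f) (x j)) : (q : ℕ∞) ≤ (extremities f).encard :=
  Alternates.le_encard_extremities hf hL.continuous hq
    (alternates_deriv_of_heatR_weak hτ hL hf hfin hq hx hxq hs)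

/-- The heat semigroup does not increase the number of extremity points of a function. -/
theorem encard_extremities_heatR_le {τ : ℝ} (hτ : 0 < τ) {f : ℝ → ℝ} {K : ℝ≥0}
    (hL : LipschitzWith K f) (hf : Function.Periodic f 1) (hfin : (extremities f).Finite) :
    (extremities (heatR τ f)).encard ≤ (extremities f).encard := by
  by_contra hcon
  rw [not_le] at hcon
  set N := (extremities f).ncard with hN
  have hNe : (extremities f).encard = N := hfin.cast_ncard_eq.symm
  obtain ⟨C, hC⟩ := exists_bound_of_periodic hf hL.continuous
  have hderiv : ∀ y, HasDerivAt (heatR τ f) (heatR τ (deriv f) y) y :=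
    hasDerivAt_heatR hτ hL hC (measurable_deriv f)
      (hL.ae_differentiableAt_real.mono fun y hy => hy.hasDerivAt)
  rw [hNe] at hcon
  obtain ⟨T, hTsub, hTcard⟩ := exists_subset_encard_eq
    (show ((N + 1 : ℕ) : ℕ∞) ≤ (extremities (heatR τ f)).encard from by
      push_cast
      exact Order.add_one_le_of_lt hcon)
  have hTfin : T.Finite := finite_of_encard_eq_coe hTcard
  have hTc : hTfin.toFinset.card = N + 1 := by
    have := hTfin.encard_eq_coe_toFinset_card
    rw [hTcard] at this
    exact_mod_cast this.symm
  let z := hTfin.toFinset.orderEmbOfFin hTc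
  have hzT : ∀ j, z j ∈ extremities (heatR τ f) := fun j =>
    hTsub (hTfin.mem_toFinset.1 (Finset.orderEmbOfFin_mem _ hTc j))
  have hz0 : ∀ j, heatR τ (deriv f) (z j) = 0 := by
    intro j
    rcases (hzT j).2 with h | h
    · exact (hderiv _).unique h
    · exact h.hasDerivAt_eq_zero (hderiv _)
  set w : ℝ := (z (Fin.last N) + (z 0 + 1)) / 2 with hw
  have hw1 : z (Fin.last N) < w := by
    have h1 := (hzT (Fin.last N)).1.2
    have h2 := (hzT 0).1.1
    rw [hw]; linarith
  have hw2 : w < z 0 + 1 := by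
    have h1 := (hzT (Fin.last N)).1.2
    have h2 := (hzT 0).1.1
    rw [hw]; linarith
  have hmono : ∀ i j : Fin (N + 1), i < j → z i < z j := fun i j h => z.strictMono h
  -- The evolved derivative has `N + 1` zeros in a period, and zeros fit any sign pattern; but a
  -- cyclic pattern needs even length.
  rcases Nat.even_or_odd (N + 1) with he | ho
  · have := le_encard_extremities_of_heatR_weak hτ hL hf hfin he
      (x := fun j => if h : j < N + 1 then z ⟨j, h⟩ else z 0 + 1) (fun j hj => by
        simp only [hj, dif_pos]
        split_ifs with h
        · exact hmono _ _ (Fin.mk_lt_mk.2 (Nat.lt_succ_self j))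
        · have hjN : (⟨j, hj⟩ : Fin (N + 1)) = Fin.last N := Fin.ext (by simp; omega)
          rw [hjN]
          linarith) (by simp) (fun j hj => by
        simp only [hj, dif_pos, hz0, mul_zero, le_refl])
    rw [hNe] at this
    have : N + 1 ≤ N := by exact_mod_cast this
    omega
  -- In the odd case one more point `w` is inserted after the last zero. Its sign is unknown; if it
  -- is the wrong one, `f` is replaced by `-f`.
  · have he : Even (N + 2) := ho.add_one
    set x : ℕ → ℝ := fun j => if h : j < N + 1 then z ⟨j, h⟩ else if j = N + 1 then w else z 0 + 1
      with hxdef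
    have hx : ∀ j < N + 2, x j < x (j + 1) := by
      intro j hj
      rcases (Nat.lt_succ_iff_lt_or_eq.1 hj) with h | h
      · simp only [hxdef, h, dif_pos]
        split_ifs with h' h''
        · exact hmono _ _ (Fin.mk_lt_mk.2 (Nat.lt_succ_self j))
        · have hjN : (⟨j, h⟩ : Fin (N + 1)) = Fin.last N := Fin.ext (by simp; omega)
          rw [hjN]
          exact hw1
        · omega
      · subst h
        simp [hxdef, hw2]
    have hxq : x (N + 2) = x 0 + 1 := by simp [hxdef]
    have hxw : x (N + 1) = w := by simp [hxdef]
    have hxz : ∀ j, j < N + 1 → heatR τ (deriv f) (x j) = 0 := fun j hj => by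
      simp only [hxdef, hj, dif_pos, hz0]
    have hle : ((N + 2 : ℕ) : ℕ∞) ≤ (extremities f).encard := by
      rcases le_total (heatR τ (deriv f) w) 0 with h | h
      · refine le_encard_extremities_of_heatR_weak hτ hL hf hfin he hx hxq fun j hj => ?_
        rcases (Nat.lt_succ_iff_lt_or_eq.1 hj) with h' | h'
        · rw [hxz j h', mul_zero]
        · rw [h', hxw, ho.neg_one_pow]
          linarith
      · rw [← extremities_neg] at hfin ⊢
        refine le_encard_extremities_of_heatR_weak hτ hL.neg (fun y => by simp [hf y]) hfin he
          hx hxq fun j hj => ?_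
        have hneg : heatR τ (deriv (-f)) (x j) = - heatR τ (deriv f) (x j) := by
          rw [deriv.neg', heatR, heatR, ← integral_neg]
        rw [hneg]
        rcases (Nat.lt_succ_iff_lt_or_eq.1 hj) with h' | h'
        · rw [hxz j h', neg_zero, mul_zero]
        · rw [h', hxw, ho.neg_one_pow]
          linarith
    rw [hNe] at hle
    have : N + 2 ≤ N := by exact_mod_cast hle
    omega

/-! ### Extremities and arc length under Lipschitz reparametrization. -/

/-- No differentiability of `θ` is needed: if `v` has derivative zero, its increment is `o(θ x - θ
r)`, hence `o(x - r)`. Local extrema need only continuity. -/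
theorem IsExtremity.comp_lipschitz {v θ : ℝ → ℝ} {K : ℝ≥0} (hθ : LipschitzWith K θ) {r : ℝ}
    (h : IsExtremity v (θ r)) : IsExtremity (v ∘ θ) r := by
  rcases h with h | h | h
  · left
    rw [hasDerivAt_iff_isLittleO] at h ⊢
    simp only [smul_zero, sub_zero] at h ⊢
    have hO : (fun x => θ x - θ r) =O[𝓝 r] fun x => x - r :=
      Asymptotics.IsBigO.of_bound K (Eventually.of_forall fun x => by
        simpa [dist_eq_norm] using hθ.dist_le_mul x r)
    exact (h.comp_tendsto hθ.continuous.continuousAt).trans_isBigO hO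
  · right; left
    exact hθ.continuous.continuousAt.tendsto.eventually h
  · right; right
    exact hθ.continuous.continuousAt.tendsto.eventually h

theorem map_add_int_of_map_add_one {θ : ℝ → ℝ} {σ : ℤ} (h : ∀ r, θ (r + 1) = θ r + σ) (r : ℝ)
    (n : ℤ) : θ (r + n) = θ r + n * σ := by
  induction n using Int.induction_on with
  | zero => simp
  | succ n ih =>
    push_cast at ih ⊢
    rw [← add_assoc, h, ih]
    ring
  | pred n ih =>
    have := h (r + ((-(n : ℤ) - 1 : ℤ) : ℝ))
    push_cast at ih this ⊢
    rw [show r + (-(n : ℝ) - 1) + 1 = r + -n by ring, ih] at this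
    linarith

/-- A unit `σ` is `1` or `-1`, so both orientations are covered. Integer translates give values
below and above any target. -/
theorem surjective_of_map_add_one {θ : ℝ → ℝ} (hc : Continuous θ) {σ : ℤ} (hσ : IsUnit σ)
    (h : ∀ r, θ (r + 1) = θ r + σ) : Function.Surjective θ := by
  intro c
  have key : ∀ m : ℤ, θ (0 + ((m * σ : ℤ) : ℝ)) = θ 0 + m := by
    intro m
    rw [map_add_int_of_map_add_one h, ← Int.cast_mul, mul_assoc, Int.isUnit_mul_self hσ, mul_one]
  refine mem_range_of_exists_le_of_exists_ge hc ⟨_, (key ⌊c - θ 0⌋).trans_le ?_⟩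
    ⟨_, (key ⌈c - θ 0⌉).ge.trans' ?_⟩
  · linarith [Int.floor_le (c - θ 0)]
  · linarith [Int.le_ceil (c - θ 0)]

/-- Extremity points of `v` come from extremity points of a Lipschitz reparametrization. -/
theorem extremities_subset_image {v θ : ℝ → ℝ} {K : ℝ≥0} (hθ : LipschitzWith K θ)
    {σ : ℤ} (hσ : IsUnit σ) (h : ∀ r, θ (r + 1) = θ r + σ) (hvθ : Function.Periodic (v ∘ θ) 1) :
    extremities v ⊆ (fun r => Int.fract (θ r)) '' extremities (v ∘ θ) := by
  rintro s ⟨hs, hext⟩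
  obtain ⟨r, rfl⟩ := surjective_of_map_add_one hθ.continuous hσ h s
  refine ⟨Int.fract r, fract_mem_extremities hvθ (hext.comp_lipschitz hθ), ?_⟩
  have h1 := map_add_int_of_map_add_one h (Int.fract r) ⌊r⌋
  rw [Int.fract_add_floor, ← Int.cast_mul] at h1
  rw [← Int.fract_eq_self.2 hs, h1]
  exact (Int.fract_add_intCast _ _).symm

/-- If the increments of a Lipschitz map are bounded by those of a monotone function, so is its
length. -/
theorem integral_norm_deriv_le_of_monotone {F : Type*} [NormedAddCommGroup F] [NormedSpace ℝ F]
    [FiniteDimensional ℝ F] {X : ℝ → F} {K : ℝ≥0} (hX : LipschitzWith K X) {v : ℝ → ℝ}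
    (hv : Monotone v) (h : ∀ s t, s ≤ t → ‖X t - X s‖ ≤ v t - v s) {c e : ℝ} (hce : c ≤ e) :
    ∫ x in c..e, ‖deriv X x‖ ≤ v e - v c := by
  have hle : ∀ᵐ x, ‖deriv X x‖ ≤ deriv v x := by
    filter_upwards [hX.ae_differentiableAt_real, hv.ae_differentiableAt] with x hx hvx
    have h1 : Tendsto (fun t => ‖slope X x t‖) (𝓝[>] x) (𝓝 ‖deriv X x‖) :=
      ((hasDerivAt_iff_tendsto_slope.1 hx.hasDerivAt).mono_left
        (nhdsWithin_mono _ fun t ht => ne_of_gt ht)).norm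
    have h2 : Tendsto (slope v x) (𝓝[>] x) (𝓝 (deriv v x)) :=
      (hasDerivAt_iff_tendsto_slope.1 hvx.hasDerivAt).mono_left
        (nhdsWithin_mono _ fun t ht => ne_of_gt ht)
    refine le_of_tendsto_of_tendsto h1 h2 ?_
    filter_upwards [self_mem_nhdsWithin] with t ht
    have ht' : 0 < t - x := sub_pos.2 ht
    simp only [slope, vsub_eq_sub]
    rw [norm_smul, Real.norm_of_nonneg (inv_nonneg.2 ht'.le), smul_eq_mul]
    exact mul_le_mul_of_nonneg_left (h x t (le_of_lt ht)) (inv_nonneg.2 ht'.le)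
  have hi1 : IntervalIntegrable (fun x => ‖deriv X x‖) volume c e :=
    (intervalIntegrable_of_bounded (stronglyMeasurable_deriv X)
      (fun _ => norm_deriv_le_of_lipschitz hX) c e).norm
  have hi2 : IntervalIntegrable (deriv v) volume c e :=
    (hv.monotoneOn _).intervalIntegrable_deriv
  refine (intervalIntegral.integral_mono_ae hce hi1 hi2 hle).trans ?_
  -- A monotone function may jump or have a singular part, so its derivative integrates to at most
  -- its increment, which is the direction needed.
  have h3 := (hv.monotoneOn (uIcc c e)).intervalIntegral_deriv_mem_uIcc
  rw [uIcc_of_le (sub_nonneg.2 (hv hce))] at h3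
  exact h3.2

variable {d : ℕ}

/-! ### The normal reparametrization. -/

section Normalize

variable {X : ℝ → E d} {K : ℝ≥0}

theorem intervalIntegrable_norm_deriv (hL : LipschitzWith K X) (a b : ℝ) :
    IntervalIntegrable (fun r => ‖deriv X r‖) volume a b :=
  (intervalIntegrable_of_bounded (stronglyMeasurable_deriv X)
    (fun _ => norm_deriv_le_of_lipschitz hL) a b).norm

theorem integral_norm_deriv_pos (hL : LipschitzWith K X)
    (hess : ∀ a b : ℝ, a < b → ∃ r ∈ Icc a b, ∃ r' ∈ Icc a b, X r ≠ X r') {a b : ℝ}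
    (hab : a < b) : 0 < ∫ r in a..b, ‖deriv X r‖ := by
  have hle : ∀ r r', r ≤ r' → ‖X r' - X r‖ ≤ ∫ t in r..r', ‖deriv X t‖ := fun r r' hr => by
    rw [← integral_deriv_of_lipschitz hL]
    exact intervalIntegral.norm_integral_le_integral_norm hr
  have key : ∀ r ∈ Icc a b, ∀ r' ∈ Icc a b, r ≤ r' → X r ≠ X r' →
      0 < ∫ t in a..b, ‖deriv X t‖ := by
    intro r hr r' hr' hrr hne
    refine (norm_pos_iff.2 (sub_ne_zero.2 hne.symm)).trans_le ((hle r r' hrr).trans ?_)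
    exact intervalIntegral.integral_mono_interval hr.1 hrr hr'.2
      (Eventually.of_forall fun _ => norm_nonneg _) (intervalIntegrable_norm_deriv hL a b)
  obtain ⟨r, hr, r', hr', hne⟩ := hess a b hab
  rcases le_total r r' with h | h
  · exact key r hr r' hr' h hne
  · exact key r' hr' r hr h hne.symm

theorem normArc_sub (hL : LipschitzWith K X) (a b : ℝ) :
    normArc X b - normArc X a = (length X)⁻¹ * ∫ r in a..b, ‖deriv X r‖ := by
  rw [normArc, normArc, ← mul_sub, intervalIntegral.integral_interval_sub_left
    (intervalIntegrable_norm_deriv hL _ _) (intervalIntegrable_norm_deriv hL _ _)]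

theorem length_pos (hL : LipschitzWith K X)
    (hess : ∀ a b : ℝ, a < b → ∃ r ∈ Icc a b, ∃ r' ∈ Icc a b, X r ≠ X r') : 0 < length X :=
  integral_norm_deriv_pos hL hess one_pos

theorem normArc_strictMono (hL : LipschitzWith K X)
    (hess : ∀ a b : ℝ, a < b → ∃ r ∈ Icc a b, ∃ r' ∈ Icc a b, X r ≠ X r') :
    StrictMono (normArc X) := by
  intro a b hab
  rw [← sub_pos, normArc_sub hL]
  exact mul_pos (inv_pos.2 (length_pos hL hess)) (integral_norm_deriv_pos hL hess hab)

theorem normArc_lipschitz (hL : LipschitzWith K X) : ∃ K', LipschitzWith K' (normArc X) := by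
  refine ⟨Real.toNNReal (|(length X)⁻¹| * K), LipschitzWith.of_dist_le_mul fun b a => ?_⟩
  rw [Real.coe_toNNReal _ (by positivity), Real.dist_eq, Real.dist_eq, normArc_sub hL, abs_mul,
    mul_assoc]
  refine mul_le_mul_of_nonneg_left ?_ (abs_nonneg _)
  exact intervalIntegral.norm_integral_le_of_norm_le_const (f := fun t => ‖deriv X t‖)
    fun t _ => (norm_norm (deriv X t)).trans_le (norm_deriv_le_of_lipschitz hL)

theorem normArc_add_one (hL : LipschitzWith K X) (hX : Function.Periodic X 1)
    (hess : ∀ a b : ℝ, a < b → ∃ r ∈ Icc a b, ∃ r' ∈ Icc a b, X r ≠ X r') (r : ℝ) :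
    normArc X (r + 1) = normArc X r + (1 : ℤ) := by
  have hp : Function.Periodic (fun t => ‖deriv X t‖) 1 := by
    intro x
    change ‖deriv X (x + 1)‖ = ‖deriv X x‖
    rw [← deriv_comp_add_const]
    congr 2
    exact funext hX
  have h1 := normArc_sub hL r (r + 1)
  rw [hp.intervalIntegral_add_eq r 0, zero_add] at h1
  change _ = (length X)⁻¹ * length X at h1
  rw [inv_mul_cancel₀ (length_pos hL hess).ne'] at h1
  push_cast
  linarith

theorem normalize_normArc (hL : LipschitzWith K X)
    (hess : ∀ a b : ℝ, a < b → ∃ r ∈ Icc a b, ∃ r' ∈ Icc a b, X r ≠ X r') (r : ℝ) :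
    normalize X (normArc X r) = X r := by
  rw [normalize, Function.leftInverse_invFun (normArc_strictMono hL hess).injective]

theorem normArc_surjective (hL : LipschitzWith K X) (hX : Function.Periodic X 1)
    (hess : ∀ a b : ℝ, a < b → ∃ r ∈ Icc a b, ∃ r' ∈ Icc a b, X r ≠ X r') :
    Function.Surjective (normArc X) :=
  surjective_of_map_add_one (normArc_lipschitz hL).choose_spec.continuous isUnit_one
    (normArc_add_one hL hX hess)

theorem normalize_periodic (hL : LipschitzWith K X) (hX : Function.Periodic X 1)
    (hess : ∀ a b : ℝ, a < b → ∃ r ∈ Icc a b, ∃ r' ∈ Icc a b, X r ≠ X r') :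
    Function.Periodic (normalize X) 1 := by
  intro s
  obtain ⟨r, rfl⟩ := normArc_surjective hL hX hess s
  have h1 := normArc_add_one hL hX hess r
  push_cast at h1
  rw [← h1, normalize_normArc hL hess, normalize_normArc hL hess, hX]

theorem normalize_lipschitz (hL : LipschitzWith K X) (hX : Function.Periodic X 1)
    (hess : ∀ a b : ℝ, a < b → ∃ r ∈ Icc a b, ∃ r' ∈ Icc a b, X r ≠ X r') :
    ∃ K', LipschitzWith K' (normalize X) := by
  have hpos := length_pos hL hess
  refine ⟨Real.toNNReal (length X), LipschitzWith.of_dist_le_mul fun s t => ?_⟩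
  obtain ⟨a, rfl⟩ := normArc_surjective hL hX hess s
  obtain ⟨b, rfl⟩ := normArc_surjective hL hX hess t
  rw [normalize_normArc hL hess, normalize_normArc hL hess, Real.coe_toNNReal _ hpos.le,
    Real.dist_eq, normArc_sub hL, abs_mul, abs_of_pos (inv_pos.2 hpos), ← mul_assoc,
    mul_inv_cancel₀ hpos.ne', one_mul, dist_eq_norm, ← integral_deriv_of_lipschitz hL]
  exact intervalIntegral.norm_integral_le_abs_integral_norm

end Normalize

/-- The arc length of a curve between two parameters is controlled by any Lipschitz
reparametrization. -/
theorem abs_integral_norm_deriv_le_of_comp {X Y : ℝ → E d} {K K' : ℝ≥0} (hX : LipschitzWith K X)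
    (hY : LipschitzWith K' Y) {φ : ℝ → ℝ} (hsurj : Function.Surjective φ)
    (hφ : StrictMono φ ∨ StrictAnti φ) (hYX : Y = X ∘ φ) (a b : ℝ) :
    |∫ x in φ a..φ b, ‖deriv X x‖| ≤ K' * |b - a| := by
  obtain ⟨η, hη⟩ := hsurj.hasRightInverse
  have hηφ : ∀ r, η (φ r) = r := fun r => by
    have : φ (η (φ r)) = φ r := hη (φ r)
    rcases hφ with h | h
    · exact h.injective this
    · exact h.injective this
  have hXη : ∀ s t, ‖X t - X s‖ ≤ K' * |η t - η s| := fun s t => by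
    have := hY.dist_le_mul (η t) (η s)
    rwa [hYX, Function.comp_apply, Function.comp_apply, hη t, hη s, dist_eq_norm,
      Real.dist_eq] at this
  -- Increments of `X = Y ∘ η` are bounded by those of the monotone function `K' η`, or of `-K' η`
  -- when the orientation is reversed.
  have key : ∀ s t, s ≤ t → ∫ x in s..t, ‖deriv X x‖ ≤ K' * |η t - η s| := by
    intro s t hst
    rcases hφ with h | h
    · have hmono : Monotone η := fun s t hst => h.le_iff_le.1 (by rwa [hη, hη])
      have := integral_norm_deriv_le_of_monotone hX (v := fun t => K' * η t)
        (hmono.const_mul K'.2) (fun s t hst => (hXη s t).trans (le_of_eq (by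
          rw [abs_of_nonneg (sub_nonneg.2 (hmono hst)), mul_sub]))) hst
      rwa [abs_of_nonneg (sub_nonneg.2 (hmono hst)), mul_sub]
    · have hanti : Antitone η := fun s t hst => h.le_iff_ge.1 (by rwa [hη, hη])
      have := integral_norm_deriv_le_of_monotone hX (v := fun t => -(K' * η t))
        (hanti.const_mul K'.2).neg (fun s t hst => (hXη s t).trans (le_of_eq (by
          rw [abs_of_nonpos (sub_nonpos.2 (hanti hst))]; ring))) hst
      rw [abs_of_nonpos (sub_nonpos.2 (hanti hst))]
      linarith
  have hnn : ∀ s t, s ≤ t → 0 ≤ ∫ x in s..t, ‖deriv X x‖ := fun s t hst =>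
    intervalIntegral.integral_nonneg hst fun _ _ => norm_nonneg _
  rcases le_total (φ a) (φ b) with h | h
  · rw [abs_of_nonneg (hnn _ _ h)]
    simpa only [hηφ] using key _ _ h
  · rw [intervalIntegral.integral_symm, abs_neg, abs_of_nonneg (hnn _ _ h), abs_sub_comm]
    simpa only [hηφ] using key _ _ h

/-! ### Extremity numbers of curves, component by component. -/

variable {d : ℕ}

/-- The component of `X` along the axis `i` of the basis `b`. -/
noncomputable def component (b : OrthonormalBasis (Fin d) ℝ (E d)) (X : ℝ → E d) (i : Fin d) (r : ℝ) : ℝ :=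
  b.repr (X r) i

section Component

variable {b : OrthonormalBasis (Fin d) ℝ (E d)} {X Y : ℝ → E d}

theorem component_periodic (hX : Function.Periodic X 1) (i : Fin d) :
    Function.Periodic (component b X i) 1 := fun r => by simp only [component, hX r]

theorem component_lipschitz {K : ℝ≥0} (hL : LipschitzWith K X) (i : Fin d) :
    LipschitzWith K (component b X i) := by
  refine LipschitzWith.of_dist_le_mul fun x y => (hL.dist_le_mul x y).trans' ?_
  rw [← b.repr.dist_map, dist_eq_norm, dist_eq_norm]
  exact PiLp.norm_apply_le (b.repr (X x) - b.repr (X y)) i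

theorem extremitySet_finite (h : ∀ i, (extremities (component b X i)).Finite) :
    (extremitySet b X).Finite := by
  refine (finite_iUnion fun i => (h i).image (Prod.mk i)).subset ?_
  rintro ⟨i, r⟩ hr
  exact mem_iUnion.2 ⟨i, r, hr, rfl⟩

theorem extremities_component_finite (h : (extremitySet b X).Finite) (i : Fin d) :
    (extremities (component b X i)).Finite :=
  h.preimage (f := Prod.mk i) (Prod.mk_right_injective i).injOn

theorem extremityNumber_le (hX : ∀ i, (extremities (component b X i)).Finite)
    (h : ∀ i, (extremities (component b X i)).encard ≤ (extremities (component b Y i)).encard) :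
    extremityNumber b X ≤ extremityNumber b Y := by
  choose f hf hinj using fun i => (hX i).exists_injOn_of_encard_le (h i)
  refine encard_le_encard_of_injOn (f := fun p => (p.1, f p.1 p.2)) ?_ ?_
  · rintro ⟨i, r⟩ hr
    exact hf i hr
  · rintro ⟨i, r⟩ hr ⟨i', r'⟩ hr' heq
    simp only [Prod.mk.injEq] at heq
    obtain ⟨rfl, h2⟩ := heq
    exact congrArg (Prod.mk i) (hinj i hr hr' h2)

end Component

/-- A Lipschitz closed curve with finitely many extremity points in the coordinates `b`. -/
structure HasFiniteExtremities (b : OrthonormalBasis (Fin d) ℝ (E d)) (X : ℝ → E d) : Prop where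
  periodic : Function.Periodic X 1
  lipschitz : ∃ K, LipschitzWith K X
  finite : ∀ i, (extremities (component b X i)).Finite

namespace HasFiniteExtremities

variable {b : OrthonormalBasis (Fin d) ℝ (E d)} {X : ℝ → E d}

theorem encard_heat_le (h : HasFiniteExtremities b X) {τ : ℝ} (hτ : 0 ≤ τ) (i : Fin d) :
    (extremities (component b (heat τ X) i)).encard ≤ (extremities (component b X i)).encard := by
  obtain ⟨K, hK⟩ := h.lipschitz
  rcases hτ.eq_or_lt with rfl | hτ
  · rw [heat_zero]
  · have h1 : component b (heat τ X) i = heatR τ (component b X i) :=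
      funext fun s => repr_heat h.periodic hK.continuous b i s
    rw [h1]
    exact encard_extremities_heatR_le hτ (component_lipschitz hK i)
      (component_periodic h.periodic i) (h.finite i)

theorem heat (h : HasFiniteExtremities b X) {τ : ℝ} (hτ : 0 ≤ τ) :
    HasFiniteExtremities b (heat τ X) := by
  obtain ⟨K, hK⟩ := h.lipschitz
  exact ⟨heat_periodic h.periodic, ⟨K, heat_lipschitz h.periodic hK⟩, fun i =>
    (h.finite i).finite_of_encard_le (h.encard_heat_le hτ i)⟩

theorem extremityNumber_heat_le (h : HasFiniteExtremities b X) {τ : ℝ} (hτ : 0 ≤ τ) :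
    extremityNumber b (CurveFlow.heat τ X) ≤ extremityNumber b X :=
  extremityNumber_le (h.heat hτ).finite (h.encard_heat_le hτ)

/-- One component with finitely many extremities already prevents constancy on intervals, so this
property need not be carried along the scheme. The condition on `d` ensures that a component exists.
-/
theorem essential [NeZero d] (h : HasFiniteExtremities b X) (r s : ℝ) (hrs : r < s) :
    ∃ x ∈ Icc r s, ∃ y ∈ Icc r s, X x ≠ X y := by
  obtain ⟨x, hx, hne⟩ := exists_ne_of_finite_extremities
    (component_periodic (b := b) h.periodic 0) (h.finite 0) hrs
  exact ⟨x, Ioo_subset_Icc_self hx, (r + s) / 2, ⟨by linarith, by linarith⟩,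
    fun heq => hne (by simp only [component, heq])⟩

theorem extremities_normalize_subset [NeZero d] (h : HasFiniteExtremities b X) (i : Fin d) :
    extremities (component b (CurveFlow.normalize X) i) ⊆
      (fun r => Int.fract (normArc X r)) '' extremities (component b X i) := by
  obtain ⟨K, hK⟩ := h.lipschitz
  obtain ⟨K', hK'⟩ := normArc_lipschitz hK
  have h1 : component b (CurveFlow.normalize X) i ∘ normArc X = component b X i :=
    funext fun r => by simp only [Function.comp, component, normalize_normArc hK h.essential]
  have h2 := extremities_subset_image (v := component b (CurveFlow.normalize X) i) hK' isUnit_one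
    (normArc_add_one hK h.periodic h.essential) (h1 ▸ component_periodic h.periodic i)
  rwa [h1] at h2

theorem normalize [NeZero d] (h : HasFiniteExtremities b X) :
    HasFiniteExtremities b (normalize X) := by
  obtain ⟨K, hK⟩ := h.lipschitz
  exact ⟨normalize_periodic hK h.periodic h.essential,
    normalize_lipschitz hK h.periodic h.essential,
    fun i => ((h.finite i).image _).subset (h.extremities_normalize_subset i)⟩

theorem extremityNumber_normalize_le [NeZero d] (h : HasFiniteExtremities b X) :
    extremityNumber b (CurveFlow.normalize X) ≤ extremityNumber b X :=
  extremityNumber_le h.normalize.finite fun i =>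
    (encard_le_encard (h.extremities_normalize_subset i)).trans (encard_image_le _ _)

end HasFiniteExtremities

/-- The normal reparametrization of a closed curve with finitely many extremity points in some
parametrization has finitely many extremity points. -/
theorem IsClosedCurve.hasFiniteExtremities_normalize {X : ℝ → E d} (hX : IsClosedCurve X)
    {b : OrthonormalBasis (Fin d) ℝ (E d)} (h : HasFinitelyManyExtremityPoints b X) :
    HasFiniteExtremities b (normalize X) := by
  obtain ⟨Y, ⟨φ, hφc, hφ, hYX⟩, hY, hfin⟩ := h
  obtain ⟨K, hK⟩ := hX.lipschitz
  obtain ⟨K', hK'⟩ := hY.lipschitz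
  refine ⟨normalize_periodic hK hX.periodic hX.essential,
    normalize_lipschitz hK hX.periodic hX.essential, fun i => ?_⟩
  have hφ' : StrictMono φ ∨ StrictAnti φ := hφ.imp And.left And.left
  obtain ⟨σ, hσ, hstep⟩ : ∃ σ : ℤ, IsUnit σ ∧ ∀ r, φ (r + 1) = φ r + σ := by
    rcases hφ with ⟨-, h⟩ | ⟨-, h⟩
    · exact ⟨1, isUnit_one, fun r => by rw [h]; simp⟩
    · exact ⟨-1, isUnit_one.neg, fun r => by rw [h]; push_cast; ring⟩
  have hsurj := surjective_of_map_add_one hφc hσ hstep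
  have hpos := length_pos hK hX.essential
  -- The homeomorphism `φ` itself need not be Lipschitz, but arc length composed with it is, since
  -- it is controlled by the Lipschitz constant of `Y`.
  have hθ : LipschitzWith (Real.toNNReal ((length X)⁻¹ * K')) (normArc X ∘ φ) := by
    refine LipschitzWith.of_dist_le_mul fun s r => ?_
    rw [Real.coe_toNNReal _ (by positivity), Real.dist_eq, Real.dist_eq, Function.comp_apply,
      Function.comp_apply, normArc_sub hK, abs_mul, abs_of_pos (inv_pos.2 hpos), mul_assoc]
    exact mul_le_mul_of_nonneg_left
      (abs_integral_norm_deriv_le_of_comp hK hK' hsurj hφ' hYX r s) (inv_pos.2 hpos).le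
  have hθstep : ∀ r, (normArc X ∘ φ) (r + 1) = (normArc X ∘ φ) r + σ := by
    intro r
    rw [Function.comp_apply, hstep,
      map_add_int_of_map_add_one (normArc_add_one hK hX.periodic hX.essential)]
    simp
  have h1 : component b (normalize X) i ∘ (normArc X ∘ φ) = component b Y i :=
    funext fun r => by
      simp only [Function.comp, component, normalize_normArc hK hX.essential, hYX]
  have h2 := extremities_subset_image (v := component b (normalize X) i) hθ hσ hθstep
    (h1 ▸ component_periodic hY.periodic i)
  rw [h1] at h2
  exact ((extremities_component_finite hfin i).image _).subset h2

theorem IsClosedCurve.neZero {X : ℝ → E d} (hX : IsClosedCurve X) : NeZero d := by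
  refine ⟨?_⟩
  rintro rfl
  obtain ⟨r, -, r', -, hne⟩ := hX.essential 0 1 one_pos
  exact hne (Subsingleton.elim _ _)

/-! ### The time-stepping scheme. -/

/-- `approximant` with the number of elapsed time steps made explicit. -/
noncomputable def stage (X₀ : ℝ → E d) (n k : ℕ) (t : ℝ) : ℝ → E d :=
  heat ((t - k * (1 / (n : ℝ))) / length (juncture X₀ n k) ^ 2) (normalize (juncture X₀ n k))

section Stage

variable {X₀ : ℝ → E d} {b : OrthonormalBasis (Fin d) ℝ (E d)} {n : ℕ}

/-- The hypothesis concerns `normalize X₀`, since `X₀` may have infinitely many extremities in its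
own parametrization. -/
theorem hasFiniteExtremities_normalize_juncture [NeZero d]
    (h : HasFiniteExtremities b (normalize X₀)) (k : ℕ) :
    HasFiniteExtremities b (normalize (juncture X₀ n k)) := by
  induction k with
  | zero => exact h
  | succ k ih => exact (ih.heat (by positivity)).normalize

theorem extremityNumber_stage_le [NeZero d] (h : HasFiniteExtremities b (normalize X₀)) {k : ℕ}
    {τ t : ℝ} (hk : k * (1 / (n : ℝ)) ≤ τ) (hτt : τ ≤ t) :
    extremityNumber b (stage X₀ n k t) ≤ extremityNumber b (stage X₀ n k τ) := by
  have hk' := hasFiniteExtremities_normalize_juncture (n := n) h k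
  obtain ⟨K, hK⟩ := hk'.lipschitz
  have h0 : 0 ≤ (τ - k * (1 / (n : ℝ))) / length (juncture X₀ n k) ^ 2 :=
    div_nonneg (by linarith) (by positivity)
  have h1 : 0 ≤ (t - τ) / length (juncture X₀ n k) ^ 2 :=
    div_nonneg (by linarith) (by positivity)
  have h2 : stage X₀ n k t = heat ((t - τ) / length (juncture X₀ n k) ^ 2) (stage X₀ n k τ) := by
    rw [stage, stage, heat_heat h1 h0 hk'.periodic hK.continuous, ← add_div]
    congr 2
    ring
  rw [h2]
  exact (hk'.heat h0).extremityNumber_heat_le h1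

/-- At a jump time the old stage ends at the juncture and the new one starts from its normal
reparametrization, so passing from one to the other adds no extremities. -/
theorem extremityNumber_stage_succ_le [NeZero d] (h : HasFiniteExtremities b (normalize X₀))
    {k : ℕ} {τ : ℝ} (hk : k * (1 / (n : ℝ)) ≤ τ) (hτ : τ ≤ (k + 1 : ℕ) * (1 / (n : ℝ))) :
    extremityNumber b (stage X₀ n (k + 1) ((k + 1 : ℕ) * (1 / (n : ℝ)))) ≤
      extremityNumber b (stage X₀ n k τ) := by
  refine le_trans ?_ (extremityNumber_stage_le h hk hτ)
  have h1 : stage X₀ n (k + 1) ((k + 1 : ℕ) * (1 / (n : ℝ))) =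
      normalize (juncture X₀ n (k + 1)) := by
    rw [stage, sub_self, zero_div, heat_zero]
  have h2 : stage X₀ n k ((k + 1 : ℕ) * (1 / (n : ℝ))) = juncture X₀ n (k + 1) := by
    rw [stage, juncture]
    congr 2
    push_cast
    ring
  rw [h1, h2]
  exact ((hasFiniteExtremities_normalize_juncture h k).heat
    (by positivity)).extremityNumber_normalize_le

theorem extremityNumber_stage_le_of_lt [NeZero d] (h : HasFiniteExtremities b (normalize X₀))
    {k l : ℕ} (hkl : k < l) {τ : ℝ} (hk : k * (1 / (n : ℝ)) ≤ τ)
    (hτ : τ ≤ (k + 1 : ℕ) * (1 / (n : ℝ))) :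
    extremityNumber b (stage X₀ n l (l * (1 / (n : ℝ)))) ≤
      extremityNumber b (stage X₀ n k τ) := by
  induction l, hkl using Nat.le_induction with
  | base => exact extremityNumber_stage_succ_le h hk hτ
  | succ l hl ih =>
    refine (extremityNumber_stage_succ_le h le_rfl ?_).trans ih
    exact mul_le_mul_of_nonneg_right (by push_cast; linarith) (by positivity)

end Stage

end CurveFlow

theorem mainTheorem10 (d : ℕ) (X₀ : ℝ → CurveFlow.E d) (hX₀ : CurveFlow.IsClosedCurve X₀)
    (b : OrthonormalBasis (Fin d) ℝ (CurveFlow.E d))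
    (hfin : CurveFlow.HasFinitelyManyExtremityPoints b X₀) (n : ℕ) (hn : 1 ≤ n) :
    (∀ t : ℝ, 0 ≤ t →
      (CurveFlow.extremitySet b (CurveFlow.approximant X₀ n t)).Finite) ∧
    ∀ τ t : ℝ, 0 ≤ τ → τ ≤ t →
      CurveFlow.extremityNumber b (CurveFlow.approximant X₀ n t) ≤
        CurveFlow.extremityNumber b (CurveFlow.approximant X₀ n τ) := by
  have := hX₀.neZero
  have h := hX₀.hasFiniteExtremities_normalize hfin
  have hn0 : (0 : ℝ) < n := by exact_mod_cast hn
  have hfloor : ∀ t : ℝ, 0 ≤ t → (⌊(n : ℝ) * t⌋₊ : ℝ) * (1 / (n : ℝ)) ≤ t := fun t ht => by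
    rw [mul_one_div, div_le_iff₀ hn0, mul_comm t]
    exact Nat.floor_le (by positivity)
  have hfloor' : ∀ t : ℝ, t ≤ (⌊(n : ℝ) * t⌋₊ + 1 : ℕ) * (1 / (n : ℝ)) := fun t => by
    rw [mul_one_div, le_div_iff₀ hn0, mul_comm t]
    push_cast
    exact (Nat.lt_floor_add_one _).le
  refine ⟨fun t ht => CurveFlow.extremitySet_finite
    ((CurveFlow.hasFiniteExtremities_normalize_juncture h _).heat
      (div_nonneg (sub_nonneg.2 (hfloor t ht)) (by positivity))).finite, fun τ t hτ hτt => ?_⟩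
  have hle : ⌊(n : ℝ) * τ⌋₊ ≤ ⌊(n : ℝ) * t⌋₊ :=
    Nat.floor_le_floor (mul_le_mul_of_nonneg_left hτt hn0.le)
  change CurveFlow.extremityNumber b (CurveFlow.stage X₀ n ⌊(n : ℝ) * t⌋₊ t) ≤
    CurveFlow.extremityNumber b (CurveFlow.stage X₀ n ⌊(n : ℝ) * τ⌋₊ τ)
  rcases hle.eq_or_lt with heq | hlt
  · rw [← heq]
    exact CurveFlow.extremityNumber_stage_le h (hfloor τ hτ) hτt
  -- The comparison passes through the start of the time step containing `t`, then back across all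
  -- jumps after `τ`.
  · exact (CurveFlow.extremityNumber_stage_le h le_rfl (hfloor t (hτ.trans hτt))).trans
      (CurveFlow.extremityNumber_stage_le_of_lt h hlt (hfloor τ hτ) (hfloor' τ))
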